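/- Consider $m$-mode lossy linear-optical networks built from the following element: a lossless two-mode linear-optical transformation (a ``beamsplitter'', given by an arbitrary $2\times 2$ unitary) acting on two distinct modes, preceded by one loss element in each of its two input arms. Every loss element acts on a single mode and transmits each photon with the same probability $\eta\in[0,1]$: it is the channel obtained by coupling the mode to an unobserved vacuum mode with transmission probability $\eta$. A network $\mathcal N$ is a finite sequence of components on $m$ modes, and its channel $\Lambda_{\mathcal N}$ on the states of the $m$-mode bosonic Fock space is the composition of the channels of its components. A path enters in some input mode, may leave each beamsplitter that it meets through either of its two output arms, and ends in some output mode. Let $\mathcal N$ be an $m$-mode network ($m\ge 1$) constructed from such elements, and let $s$ be the smallest number of beamsplitters traversed by any path from an input mode to an output mode. Let $\Lambda_{\eta'}$ denote uniform loss, that is, one loss element of transmissivity $\eta'$ in each of the $m$ modes. Then there is a network $\tilde{\mathcal N}$, depending only on the arrangement of the components of $\mathcal N$ (not on $\eta$ or on the values of the unitaries), such that for every choice of the unitaries and every $\eta\in[0,1]$ $$\Lambda_{\mathcal N}=\Lambda_{\tilde{\mathcal N}}\circ\Lambda_{\eta^s}.$$ The network $\tilde{\mathcal N}$ has the same beamsplitters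 in the same order as $\mathcal N$ and exactly $sm$ fewer loss elements, all of transmissivity $\eta$. It is what remains when loss elements are moved through $\mathcal N$ (past components acting on other modes, past each other, and in pairs from the two output arms of a beamsplitter to its two input arms) until there are $s$ uniform layers of losses, each with one loss element in every mode, at the input, and these $s$ layers are removed. Moreover, one fixed algorithm computes the description of $\tilde{\mathcal N}$ from the description of $\mathcal N$ in time polynomial in $m$ and the number of components of $\mathcal N$ (on a random access machine with unit-cost additions and subtractions, where a description lists the number of modes and, for each component, its kind, its modes and, for a beamsplitter, the name of its unitary). -/

import Mathlib

open scoped ComplexOrder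

namespace LossyOptics

/-! ### Bosonic states

The Fock space of `m` bosonic modes has the orthonormal basis of occupation number states `|n⟩`,
`n : Fin m →₀ ℕ`. Operators are given by their matrix elements in that basis. -/

/-- The operator with matrix elements `⟨p| ρ |q⟩ = ρ p q` in the occupation number basis. -/
abbrev FockOp (m : ℕ) : Type := Matrix (Fin m →₀ ℕ) (Fin m →₀ ℕ) ℂ

/-- Density operators: positive semidefinite with trace one. The number of particles need neither be
bounded nor definite. -/
def IsState {m : ℕ} (ρ : FockOp m) : Prop :=
  ρ.PosSemidef ∧ HasSum (fun n => ρ n n) 1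

/-! ### Loss elements -/

/-- The amplitude `⟨n| K_k |n + k e_i⟩ = √(C(n_i + k, k) η^{n_i} (1 - η)^k)` of the Kraus operator
`K_k` "exactly `k` photons of mode `i` are lost" of a loss element in mode `i`; all other matrix
elements of `K_k` vanish. -/
noncomputable def lossAmplitude {m : ℕ} (η : ℝ) (i : Fin m) (k : ℕ) (n : Fin m →₀ ℕ) : ℂ :=
  ((Real.sqrt (((n i + k).choose k : ℝ) * η ^ (n i) * (1 - η) ^ k) : ℝ) : ℂ)

/-- The channel `ρ ↦ ∑ₖ K_k ρ K_k†` of one loss element with transmissivity (single-photon survival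
probability) `η` in mode `i`: the mode is coupled to an unobserved mode in the vacuum by a
beamsplitter that transmits each photon with probability `η`. -/
noncomputable def lossChannel {m : ℕ} (η : ℝ) (i : Fin m) (ρ : FockOp m) : FockOp m :=
  fun p q => ∑' k : ℕ, lossAmplitude η i k p *
    ρ (p + Finsupp.single i k) (q + Finsupp.single i k) * star (lossAmplitude η i k q)

/-- Uniform losses with transmissivity `η`: a loss element with transmissivity `η` in every mode. -/
noncomputable def uniformLoss {m : ℕ} (η : ℝ) (ρ : FockOp m) : FockOp m :=
  (List.finRange m).foldl (fun σ i => lossChannel η i σ) ρ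

/-! ### Lossless two-mode transformations -/

/-- The image of the creation operator of mode `a` under the transformation of the modes `i`, `j`
given by the `2 × 2` matrix `V`: `a†_i ↦ V₀₀ a†_i + V₀₁ a†_j`, `a†_j ↦ V₁₀ a†_i + V₁₁ a†_j`, and
`a†_k ↦ a†_k` for the other modes. Creation operators commute; they are the variables of a
polynomial ring. -/
noncomputable def creationImage {m : ℕ} (V : Matrix (Fin 2) (Fin 2) ℂ) (i j a : Fin m) :
    MvPolynomial (Fin m) ℂ :=
  if a = i then MvPolynomial.C (V 0 0) * MvPolynomial.X i + MvPolynomial.C (V 0 1) * MvPolynomial.X j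
  else if a = j then
    MvPolynomial.C (V 1 0) * MvPolynomial.X i + MvPolynomial.C (V 1 1) * MvPolynomial.X j
  else MvPolynomial.X a

/-- `n! = ∏ₐ nₐ!`. -/
def occFactorial {m : ℕ} (n : Fin m →₀ ℕ) : ℕ := ∏ a, (n a).factorial

/-- The matrix element `⟨p| φ(V) |n⟩` of the operator on Fock space induced by `V`. Since
`|n⟩ = (n!)^{-1/2} ∏ₐ (a†_a)^{nₐ} |0⟩`, the vector `φ(V)|n⟩` is obtained by substituting the images of
the creation operators, and a monomial with exponents `p` contributes `(p!)^{1/2} |p⟩`. -/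
noncomputable def gateAmplitude {m : ℕ} (V : Matrix (Fin 2) (Fin 2) ℂ) (i j : Fin m)
    (p n : Fin m →₀ ℕ) : ℂ :=
  ((Real.sqrt ((occFactorial p : ℝ) / (occFactorial n : ℝ)) : ℝ) : ℂ) *
    MvPolynomial.coeff p (∏ a, creationImage V i j a ^ n a)

/-- The channel `ρ ↦ φ(V) ρ φ(V)†`. The sums are over the occupation numbers with as many photons as
`p` and `q`, because `φ(V)` preserves the number of photons (all other amplitudes vanish). -/
noncomputable def gateChannel {m : ℕ} (V : Matrix (Fin 2) (Fin 2) ℂ) (i j : Fin m)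
    (ρ : FockOp m) : FockOp m :=
  fun p q =>
    ∑ n ∈ Finset.finsuppAntidiag Finset.univ p.degree,
      ∑ n' ∈ Finset.finsuppAntidiag Finset.univ q.degree,
        gateAmplitude V i j p n * ρ n n' * star (gateAmplitude V i j q n')

/-! ### Networks -/

/-- A lossless two-mode element ("beamsplitter") acting on two distinct modes. The number `gate` is
the name of its `2 × 2` unitary matrix in a table of unitaries. -/
structure Beamsplitter (m : ℕ) where
  fst : Fin m
  snd : Fin m
  ne : fst ≠ snd
  gate : ℕ

/-- The components of a lossy network. -/
inductive Component (m : ℕ) : Type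
  | loss (i : Fin m) : Component m
  | split (b : Beamsplitter m) : Component m

/-- A network on `m` modes: its components in the order in which the light meets them. -/
abbrev Network (m : ℕ) : Type := List (Component m)

/-- The lossy building block: one loss element in each of the two input arms of a beamsplitter. -/
def block {m : ℕ} (b : Beamsplitter m) : Network m :=
  [Component.loss b.fst, Component.loss b.snd, Component.split b]

/-- The network constructed out of the lossy building blocks with the given beamsplitters. -/
def lossyNetwork {m : ℕ} (bs : List (Beamsplitter m)) : Network m := bs.flatMap block

/-- The channel of a component, with the table `U` of unitaries and loss elements of
transmissivity `η`. -/
noncomputable def Component.channel {m : ℕ} (U : ℕ → Matrix.unitaryGroup (Fin 2) ℂ) (η : ℝ) :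
    Component m → FockOp m → FockOp m
  | Component.loss i, ρ => lossChannel η i ρ
  | Component.split b, ρ => gateChannel (U b.gate : Matrix (Fin 2) (Fin 2) ℂ) b.fst b.snd ρ

/-- The channel `Λ_N` of a network: the composition of the channels of its components. -/
noncomputable def networkChannel {m : ℕ} (U : ℕ → Matrix.unitaryGroup (Fin 2) ℂ) (η : ℝ)
    (N : Network m) (ρ : FockOp m) : FockOp m :=
  N.foldl (fun σ c => c.channel U η σ) ρ

/-- `PathCrosses N a b k`: some path from input mode `a` to output mode `b` of `N` traverses exactly
`k` beamsplitters. A path that enters a beamsplitter may leave it by either of its two modes. -/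
inductive PathCrosses {m : ℕ} : Network m → Fin m → Fin m → ℕ → Prop
  | nil (a : Fin m) : PathCrosses [] a a 0
  | loss (i : Fin m) {N : Network m} {a b : Fin m} {k : ℕ} :
      PathCrosses N a b k → PathCrosses (Component.loss i :: N) a b k
  | pass (e : Beamsplitter m) {N : Network m} {a b : Fin m} {k : ℕ} :
      a ≠ e.fst → a ≠ e.snd → PathCrosses N a b k → PathCrosses (Component.split e :: N) a b k
  | cross (e : Beamsplitter m) {N : Network m} {a a' b : Fin m} {k : ℕ} :
      (a = e.fst ∨ a = e.snd) → (a' = e.fst ∨ a' = e.snd) →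
      PathCrosses N a' b k → PathCrosses (Component.split e :: N) a b (k + 1)

/-- The beamsplitters of a network, in order. -/
def beamsplitters {m : ℕ} (N : Network m) : List (Beamsplitter m) :=
  N.filterMap fun
    | Component.loss _ => none
    | Component.split b => some b

/-- The number of loss elements of a network. -/
def lossCount {m : ℕ} (N : Network m) : ℕ :=
  N.countP fun
    | Component.loss _ => true
    | Component.split _ => false

/-- One uniform layer of losses: one loss element in each mode. -/
def uniformLayer (m : ℕ) : Network m := (List.finRange m).map Component.loss

/-- One step of moving loss elements through a network. The rules `comm`, `left` and `right` only
exchange components without a common beamsplitter, which does not change the network as a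
diagram; `pull` moves one loss element from each of the two output arms of a beamsplitter to its two
input arms. -/
inductive Move {m : ℕ} : Network m → Network m → Prop
  | comm (A B : Network m) (i j : Fin m) :
      Move (A ++ [Component.loss i, Component.loss j] ++ B)
        (A ++ [Component.loss j, Component.loss i] ++ B)
  | left (A B : Network m) (b : Beamsplitter m) (i : Fin m) : i ≠ b.fst → i ≠ b.snd →
      Move (A ++ [Component.split b, Component.loss i] ++ B)
        (A ++ [Component.loss i, Component.split b] ++ B)
  | right (A B : Network m) (b : Beamsplitter m) (i : Fin m) : i ≠ b.fst → i ≠ b.snd →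
      Move (A ++ [Component.loss i, Component.split b] ++ B)
        (A ++ [Component.split b, Component.loss i] ++ B)
  | pull (A B : Network m) (b : Beamsplitter m) :
      Move (A ++ [Component.split b, Component.loss b.fst, Component.loss b.snd] ++ B)
        (A ++ [Component.loss b.fst, Component.loss b.snd, Component.split b] ++ B)

/-- `PullsOut N s N'`: moving loss elements through `N` yields `s` uniform layers of losses at the
input followed by `N'`; that is, `N'` is left over when `s` uniform layers of losses are pulled out of
`N` and removed. -/
def PullsOut {m : ℕ} (N : Network m) (s : ℕ) (N' : Network m) : Prop :=
  Relation.ReflTransGen Move N ((List.replicate s (uniformLayer m)).flatten ++ N')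

/-! ### Efficient computation

A random access machine with additions and subtractions, programmed in a structured language. It has
registers and arrays that hold natural numbers. Every arithmetic operation, memory access,
assignment and test costs one step. -/

/-- The contents of the memory: register `r` holds `reg r`, cell `k` of array `A` holds `arr A k`. -/
structure Store where
  reg : ℕ → ℕ
  arr : ℕ → ℕ → ℕ

/-- Expressions. -/
inductive Expr : Type
  | const (n : ℕ) : Expr
  | var (r : ℕ) : Expr
  | add (e₁ e₂ : Expr) : Expr
  | sub (e₁ e₂ : Expr) : Expr
  | get (A : ℕ) (e : Expr) : Expr

/-- The value of an expression; subtraction is truncated at `0`. -/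
def Expr.eval (σ : Store) : Expr → ℕ
  | Expr.const n => n
  | Expr.var r => σ.reg r
  | Expr.add e₁ e₂ => e₁.eval σ + e₂.eval σ
  | Expr.sub e₁ e₂ => e₁.eval σ - e₂.eval σ
  | Expr.get A e => σ.arr A (e.eval σ)

/-- The number of steps for the evaluation of an expression. -/
def Expr.cost : Expr → ℕ
  | Expr.const _ => 1
  | Expr.var _ => 1
  | Expr.add e₁ e₂ => e₁.cost + e₂.cost + 1
  | Expr.sub e₁ e₂ => e₁.cost + e₂.cost + 1
  | Expr.get _ e => e.cost + 1

/-- Programs: `set r e` is `reg r := e`, `put A e₁ e₂` is `arr A e₁ := e₂`, `ite e₁ e₂ P Q` is "if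
`e₁ < e₂` then `P` else `Q`", and `loop e₁ e₂ P` is "while `e₁ < e₂` do `P`". -/
inductive Program : Type
  | skip : Program
  | set (r : ℕ) (e : Expr) : Program
  | put (A : ℕ) (e₁ e₂ : Expr) : Program
  | seq (P Q : Program) : Program
  | ite (e₁ e₂ : Expr) (P Q : Program) : Program
  | loop (e₁ e₂ : Expr) (P : Program) : Program

/-- `Runs P σ σ' t`: started with memory `σ`, the program `P` halts after `t` steps with memory
`σ'`. -/
inductive Runs : Program → Store → Store → ℕ → Prop
  | skip (σ : Store) : Runs Program.skip σ σ 1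
  | set (r : ℕ) (e : Expr) (σ : Store) :
      Runs (Program.set r e) σ { σ with reg := Function.update σ.reg r (e.eval σ) } (e.cost + 1)
  | put (A : ℕ) (e₁ e₂ : Expr) (σ : Store) :
      Runs (Program.put A e₁ e₂) σ
        { σ with arr :=
            Function.update σ.arr A (Function.update (σ.arr A) (e₁.eval σ) (e₂.eval σ)) }
        (e₁.cost + e₂.cost + 1)
  | seq {P Q : Program} {σ σ' σ'' : Store} {t t' : ℕ} :
      Runs P σ σ' t → Runs Q σ' σ'' t' → Runs (Program.seq P Q) σ σ'' (t + t')
  | ite_true {e₁ e₂ : Expr} {P Q : Program} {σ σ' : Store} {t : ℕ} :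
      e₁.eval σ < e₂.eval σ → Runs P σ σ' t →
      Runs (Program.ite e₁ e₂ P Q) σ σ' (e₁.cost + e₂.cost + 1 + t)
  | ite_false {e₁ e₂ : Expr} {P Q : Program} {σ σ' : Store} {t : ℕ} :
      ¬ e₁.eval σ < e₂.eval σ → Runs Q σ σ' t →
      Runs (Program.ite e₁ e₂ P Q) σ σ' (e₁.cost + e₂.cost + 1 + t)
  | loop_true {e₁ e₂ : Expr} {P : Program} {σ σ' σ'' : Store} {t t' : ℕ} :
      e₁.eval σ < e₂.eval σ → Runs P σ σ' t → Runs (Program.loop e₁ e₂ P) σ' σ'' t' →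
      Runs (Program.loop e₁ e₂ P) σ σ'' (e₁.cost + e₂.cost + 1 + t + t')
  | loop_false {e₁ e₂ : Expr} {P : Program} {σ : Store} :
      ¬ e₁.eval σ < e₂.eval σ → Runs (Program.loop e₁ e₂ P) σ σ (e₁.cost + e₂.cost + 1)

/-- The initial memory: the input is in array `0`, its length is in register `0`, and everything else
is `0`. -/
def initialStore (input : List ℕ) : Store where
  reg := fun r => if r = 0 then input.length else 0
  arr := fun A k => if A = 0 then input.getD k 0 else 0

/-- On the given input, `P` halts after at most `t` steps with the output in array `1` and the length
of the output in register `1`. -/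
def ComputesWithin (P : Program) (input output : List ℕ) (t : ℕ) : Prop :=
  ∃ (σ : Store) (t' : ℕ), t' ≤ t ∧ Runs P (initialStore input) σ t' ∧
    σ.reg 1 = output.length ∧ ∀ k < output.length, σ.arr 1 k = output.getD k 0

/-- The description of a component: its kind and its modes, and the name of the unitary of a
beamsplitter. -/
def Component.words {m : ℕ} : Component m → List ℕ
  | Component.loss i => [0, (i : ℕ)]
  | Component.split b => [1, (b.fst : ℕ), (b.snd : ℕ), b.gate]

/-- The description of a network: the number of modes and the list of the components. -/
def describe {m : ℕ} (N : Network m) : List ℕ := m :: N.flatMap Component.words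

end LossyOptics

/-! The theorem rests on one physical fact: equal losses in both arms of a lossless beamsplitter
commute with it. Let `J_S` be the sum over the modes `c` in `S` of the maps `ρ ↦ a_c ρ a_c†`, and
`N_S` the number of photons in `S`. The channel of losses in `S` is the series over `d` of `√η^{N_S}
((1-η)^d / d!) J_S^d(ρ) √η^{N_S}` (`lossTerm_eq`, `IsTraceClass.hasSum_jumpTerm_pair`). A gate whose
two modes are both in `S` or both outside preserves `N_S` (`gateAmplitude_eq_zero`). It also
commutes with `J_S`, because it mixes the annihilation operators by a matrix with orthonormal rows
(`gateAmplitude_lower`, `modeMatrix_orthogonal`). So every term of the series commutes with the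
gate, and each move leaves the channel unchanged (`networkChannel_move`).

The states may have unboundedly many photons, so the loss series are genuinely infinite.
Interchanging them is justified by staying among positive operators of finite trace, where `|ρ_pq| ≤
ρ_pp + ρ_qq`. Gates and losses preserve this class. Successive losses in one mode multiply their
transmissivities (`lossChannel_lossChannel`), so `s` uniform layers act as `Λ_{η^s}`.

The rest is combinatorics. Going backwards through the network, the number of losses available at
the input of mode `a` is the distance `outDist` from `a` to the output: at a beamsplitter the
smaller of the two numbers in its output arms can be pulled through in pairs, and the building block
adds one more in each arm (`Moves.lossyNetwork`). This is the recursion for shortest paths, so the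
minimum over the modes is `s`. The program evaluates the same recursion and then writes what is left
over. -/

namespace LossyOptics

/-! ### Sums over the occupation numbers of a fixed number of photons -/

/-- The occupation numbers with `N` photons. -/
abbrev sector (m N : ℕ) : Finset (Fin m →₀ ℕ) := Finset.finsuppAntidiag Finset.univ N

theorem mem_sector {m N : ℕ} {n : Fin m →₀ ℕ} : n ∈ sector m N ↔ n.degree = N := by
  rw [Finset.mem_finsuppAntidiag, Finsupp.degree_eq_sum]
  simp

/-- Adding a photon in mode `c` maps the sector of `N` photons bijectively onto the part of the next
sector where `c` is occupied. The other terms vanish by `hf`, which in the uses comes from a factor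
`n c` or its root. -/
theorem sum_sector_succ {m : ℕ} {R : Type*} [AddCommMonoid R] (N : ℕ) (c : Fin m)
    (f : (Fin m →₀ ℕ) → R) (hf : ∀ n, n c = 0 → f n = 0) :
    ∑ n ∈ sector m (N + 1), f n = ∑ n ∈ sector m N, f (n + Finsupp.single c 1) := by
  symm
  refine Finset.sum_of_injOn (fun n => n + Finsupp.single c 1) ?_ ?_ ?_ ?_
  · intro a _ b _ h
    exact add_right_cancel h
  · intro n hn
    simp only [Finset.mem_coe, mem_sector] at hn ⊢
    rw [map_add, hn, Finsupp.degree_single]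
  · intro n hn hn'
    apply hf
    by_contra hc
    apply hn'
    have hle : Finsupp.single c 1 ≤ n := by
      rw [Finsupp.single_le_iff]; omega
    refine ⟨n - Finsupp.single c 1, ?_, tsub_add_cancel_of_le hle⟩
    rw [Finset.mem_coe, mem_sector] at *
    have := congrArg Finsupp.degree (tsub_add_cancel_of_le hle)
    rw [map_add, hn, Finsupp.degree_single] at this
    omega
  · intro n _
    rfl

theorem occFactorial_add_single {m : ℕ} (n : Fin m →₀ ℕ) (c : Fin m) :
    occFactorial (n + Finsupp.single c 1) = (n c + 1) * occFactorial n := by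
  unfold occFactorial
  rw [← Finset.mul_prod_erase _ _ (Finset.mem_univ c),
    ← Finset.mul_prod_erase Finset.univ (fun a => (n a).factorial) (Finset.mem_univ c), ← mul_assoc]
  congr 1
  · simp [Nat.factorial_succ]
  · refine Finset.prod_congr rfl fun a ha => ?_
    rw [Finsupp.add_apply, Finsupp.single_eq_of_ne (Finset.ne_of_mem_erase ha), add_zero]

theorem occFactorial_pos {m : ℕ} (n : Fin m →₀ ℕ) : 0 < occFactorial n :=
  Finset.prod_pos fun a _ => (n a).factorial_pos

/-! ### Creation operators under a two-mode transformation -/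

/-- The `m × m` matrix of the transformation of the creation operators by `creationImage`. -/
def modeMatrix {m : ℕ} (V : Matrix (Fin 2) (Fin 2) ℂ) (i j a c : Fin m) : ℂ :=
  if a = i then (if c = i then V 0 0 else if c = j then V 0 1 else 0)
  else if a = j then (if c = i then V 1 0 else if c = j then V 1 1 else 0)
  else if c = a then 1 else 0

theorem pderiv_creationImage {m : ℕ} (V : Matrix (Fin 2) (Fin 2) ℂ) {i j : Fin m} (hij : i ≠ j)
    (a c : Fin m) :
    MvPolynomial.pderiv c (creationImage V i j a) = MvPolynomial.C (modeMatrix V i j a c) := by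
  unfold creationImage modeMatrix
  split_ifs <;>
    simp_all [MvPolynomial.pderiv_X, Pi.single_apply, Derivation.leibniz, eq_comm]

/-- The Leibniz rule, by induction on the total degree, splitting off one factor at a time. The
truncated subtraction in the exponents is harmless: the coefficient `n b` vanishes whenever it
truncates. -/
theorem pderiv_prod_pow {m : ℕ} (f : Fin m → MvPolynomial (Fin m) ℂ) (c : Fin m)
    (n : Fin m →₀ ℕ) :
    MvPolynomial.pderiv c (∏ a, f a ^ n a) =
      ∑ b, (n b : MvPolynomial (Fin m) ℂ) * MvPolynomial.pderiv c (f b) *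
        ∏ a, f a ^ (n - Finsupp.single b 1 : Fin m →₀ ℕ) a := by
  have hP : ∀ (n : Fin m →₀ ℕ) (b : Fin m),
      ∏ a, f a ^ (n + Finsupp.single b 1 : Fin m →₀ ℕ) a = f b * ∏ a, f a ^ n a := by
    intro n b
    simp only [Finsupp.add_apply, pow_add, Finset.prod_mul_distrib]
    rw [mul_comm]
    congr 1
    rw [Finset.prod_eq_single b]
    · simp
    · intro a _ hab
      rw [Finsupp.single_eq_of_ne hab, pow_zero]
    · simp
  induction hN : n.degree generalizing n with
  | zero =>
    rw [Finsupp.degree_eq_zero_iff] at hN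
    subst hN
    simp
  | succ N ih =>
    obtain ⟨b₀, hb₀⟩ : ∃ b, n b ≠ 0 := by
      by_contra! h
      have : n = 0 := Finsupp.ext h
      simp [this] at hN
    have hle : Finsupp.single b₀ 1 ≤ n := by
      rw [Finsupp.single_le_iff]; omega
    obtain ⟨k, rfl⟩ : ∃ k, n = k + Finsupp.single b₀ 1 := ⟨_, (tsub_add_cancel_of_le hle).symm⟩
    have hk : k.degree = N := by
      rw [map_add, Finsupp.degree_single] at hN; omega
    rw [hP, Derivation.leibniz, ih k hk]
    simp only [smul_eq_mul]
    -- Raising the exponent of `f b₀` multiplies each old term by `f b₀` and contributes a single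
    -- new term, at `b = b₀`.
    have hterm : ∀ b, ((k + Finsupp.single b₀ 1 : Fin m →₀ ℕ) b : MvPolynomial (Fin m) ℂ) *
        MvPolynomial.pderiv c (f b) *
          ∏ a, f a ^ (k + Finsupp.single b₀ 1 - Finsupp.single b 1 : Fin m →₀ ℕ) a =
        f b₀ * ((k b : MvPolynomial (Fin m) ℂ) * MvPolynomial.pderiv c (f b) *
          ∏ a, f a ^ (k - Finsupp.single b 1 : Fin m →₀ ℕ) a) +
        (if b = b₀ then (∏ a, f a ^ k a) * MvPolynomial.pderiv c (f b) else 0) := by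
      intro b
      have hkb : (k b : MvPolynomial (Fin m) ℂ) *
          ∏ a, f a ^ (k + Finsupp.single b₀ 1 - Finsupp.single b 1 : Fin m →₀ ℕ) a =
          (k b : MvPolynomial (Fin m) ℂ) * (f b₀ * ∏ a, f a ^ (k - Finsupp.single b 1 : Fin m →₀ ℕ) a) := by
        by_cases h : k b = 0
        · simp [h]
        · have hle : Finsupp.single b 1 ≤ k := by
            rw [Finsupp.single_le_iff]; omega
          rw [← hP, tsub_add_eq_add_tsub hle]
      rw [Finsupp.add_apply, Nat.cast_add, add_mul, add_mul, mul_right_comm, hkb]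
      congr 1
      · ring
      · split_ifs with h
        · subst h
          simp [mul_comm]
        · rw [Finsupp.single_eq_of_ne h]
          simp
    rw [Finset.sum_congr rfl fun b _ => hterm b, Finset.sum_add_distrib, Finset.mul_sum]
    simp [add_comm]

/-- This is `a_c φ(V) = φ(V) ∑_b M_bc a_b` in matrix elements, with `M` the mode matrix. On
polynomials in the creation operators `a_c` acts as the partial derivative in variable `c`, so the
identity is the chain rule; the square roots come from the normalisation of the number states. -/
theorem gateAmplitude_lower {m : ℕ} (V : Matrix (Fin 2) (Fin 2) ℂ) {i j : Fin m} (hij : i ≠ j)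
    (c : Fin m) (p n : Fin m →₀ ℕ) :
    ((Real.sqrt (p c + 1) : ℝ) : ℂ) * gateAmplitude V i j (p + Finsupp.single c 1) n =
      ∑ b, modeMatrix V i j b c *
        (((Real.sqrt (n b) : ℝ) : ℂ) * gateAmplitude V i j p (n - Finsupp.single b 1)) := by
  have hp := occFactorial_pos p
  have hn := occFactorial_pos n
  have h1 : ((Real.sqrt (p c + 1) : ℝ) : ℂ) * gateAmplitude V i j (p + Finsupp.single c 1) n =
      ((Real.sqrt (occFactorial p / occFactorial n) : ℝ) : ℂ) *
        MvPolynomial.coeff p (MvPolynomial.pderiv c (∏ a, creationImage V i j a ^ n a)) := by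
    have : Real.sqrt (p c + 1) *
        Real.sqrt ((occFactorial (p + Finsupp.single c 1) : ℝ) / occFactorial n) =
        Real.sqrt (occFactorial p / occFactorial n) * (p c + 1) := by
      rw [occFactorial_add_single, Nat.cast_mul, mul_div_assoc, Real.sqrt_mul (by positivity)]
      push_cast
      rw [← mul_assoc, Real.mul_self_sqrt (by positivity), mul_comm]
    rw [gateAmplitude, ← mul_assoc, ← Complex.ofReal_mul, this, MvPolynomial.coeff_pderiv]
    push_cast
    ring
  rw [h1, pderiv_prod_pow, MvPolynomial.coeff_sum, Finset.mul_sum]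
  refine Finset.sum_congr rfl fun b _ => ?_
  rw [pderiv_creationImage V hij, gateAmplitude]
  have h2 : ((n b : ℕ) : MvPolynomial (Fin m) ℂ) = MvPolynomial.C (n b : ℂ) := by simp
  rw [h2, ← MvPolynomial.C_mul, MvPolynomial.coeff_C_mul]
  by_cases hb : n b = 0
  · simp [hb]
  have hle : Finsupp.single b 1 ≤ n := by
    rw [Finsupp.single_le_iff]; omega
  obtain ⟨k, rfl⟩ : ∃ k, n = k + Finsupp.single b 1 := ⟨_, (tsub_add_cancel_of_le hle).symm⟩
  rw [add_tsub_cancel_right]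
  have hk := occFactorial_pos k
  have h3 : Real.sqrt (occFactorial p / (occFactorial (k + Finsupp.single b 1) : ℕ)) *
      ((k + Finsupp.single b 1 : Fin m →₀ ℕ) b : ℝ) =
      Real.sqrt ((k + Finsupp.single b 1 : Fin m →₀ ℕ) b : ℝ) * Real.sqrt (occFactorial p / occFactorial k) := by
    rw [occFactorial_add_single]
    simp only [Finsupp.add_apply, Finsupp.single_eq_same]
    have hx : (0 : ℝ) < (k b + 1 : ℕ) := by positivity
    rw [Nat.cast_mul, mul_comm ((k b + 1 : ℕ) : ℝ) (occFactorial k : ℝ), ← div_div,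
      Real.sqrt_div' _ hx.le, div_mul_eq_mul_div, mul_div_assoc,
      Real.div_sqrt, mul_comm]
  have h4 := congrArg (fun x : ℝ => (x : ℂ)) h3
  simp only [Complex.ofReal_mul, Complex.ofReal_natCast] at h4
  linear_combination
    (modeMatrix V i j b c * MvPolynomial.coeff p (∏ a, creationImage V i j a ^ k a)) * h4

/-- The mode matrix is `V` on the modes `i`, `j` and the identity elsewhere. Since `S` contains both
or neither of `i`, `j`, every row is supported inside or outside `S`, so restricting the sum to `S`
only discards entire rows. -/
theorem modeMatrix_orthogonal {m : ℕ} {V : Matrix (Fin 2) (Fin 2) ℂ} (hV : V * star V = 1)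
    {i j : Fin m} (hij : i ≠ j) (S : Finset (Fin m)) (hS : i ∈ S ↔ j ∈ S) (b b' : Fin m) :
    ∑ c ∈ S, modeMatrix V i j b c * star (modeMatrix V i j b' c) =
      if b = b' ∧ b ∈ S then 1 else 0 := by
  have h00 := congrFun (congrFun hV 0) 0
  have h01 := congrFun (congrFun hV 0) 1
  have h10 := congrFun (congrFun hV 1) 0
  have h11 := congrFun (congrFun hV 1) 1
  simp only [Matrix.mul_apply, Fin.sum_univ_two, Matrix.star_apply, Matrix.one_apply_eq] at h00 h11
  rw [Matrix.one_apply_ne (by decide)] at h01 h10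
  simp only [Matrix.mul_apply, Fin.sum_univ_two, Matrix.star_apply] at h01 h10
  have key : ∀ x y x' y' : ℂ, ∑ c ∈ S, (if c = i then x else if c = j then y else 0) *
      star (if c = i then x' else if c = j then y' else 0) =
      if i ∈ S then x * star x' + y * star y' else 0 := by
    intro x y x' y'
    have : ∀ c ∈ S, (if c = i then x else if c = j then y else 0) *
      star (if c = i then x' else if c = j then y' else 0) =
        (if c = i then x * star x' else 0) + (if c = j then y * star y' else 0) := by
      intro c _
      split_ifs <;> simp_all
    rw [Finset.sum_congr rfl this, Finset.sum_add_distrib, Finset.sum_ite_eq', Finset.sum_ite_eq']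
    simp only [← hS]
    split_ifs <;> simp
  -- A row of `i` or `j` and the row of an untouched mode have disjoint supports.
  have key2 : ∀ (x y : ℂ) (d : Fin m), d ≠ i → d ≠ j →
      ∀ c, (if c = i then x else if c = j then y else 0) *
        star (if c = d then (1 : ℂ) else 0) = 0 ∧
        (if c = d then (1 : ℂ) else 0) *
        star (if c = i then x else if c = j then y else 0) = 0 := by
    intro x y d h1 h2 c
    split_ifs <;> simp_all
  unfold modeMatrix
  by_cases hbi : b = i
  · subst hbi
    by_cases hb'i : b' = b
    · subst hb'i
      simp only [if_true, key, h00]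
      simp
    · by_cases hb'j : b' = j
      · subst hb'j
        simp only [if_true, if_neg hij.symm, key, h01]
        simp [hij]
      · simp only [if_true, if_neg hb'i, if_neg hb'j, key2 _ _ _ hb'i hb'j, Finset.sum_const_zero]
        simp [Ne.symm hb'i]
  · by_cases hbj : b = j
    · subst hbj
      by_cases hb'i : b' = i
      · subst hb'i
        simp only [if_true, if_neg hbi, key, h10]
        simp [hbi]
      · by_cases hb'j : b' = b
        · subst hb'j
          simp only [if_true, if_neg hbi, key, h11, hS]
          simp
        · simp only [if_true, if_neg hb'i, if_neg hb'j, key2 _ _ _ hb'i hb'j, if_neg hbi,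
            Finset.sum_const_zero]
          simp [Ne.symm hb'j]
    · by_cases hb'i : b' = i
      · subst hb'i
        simp only [if_true, if_neg hbi, if_neg hbj, key2 _ _ _ hbi hbj, Finset.sum_const_zero]
        simp [hbi]
      · by_cases hb'j : b' = j
        · subst hb'j
          simp only [if_true, if_neg hbi, if_neg hbj, key2 _ _ _ hbi hbj, Finset.sum_const_zero,
            if_neg hb'i]
          simp [hbj]
        · simp only [if_neg hbi, if_neg hbj, if_neg hb'i, if_neg hb'j]
          by_cases hbb : b = b'
          · subst hbb
            simp
          · simp [hbb, Ne.symm hbb]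

/-! ### Annihilation operators and gates -/

/-- `ρ ↦ a_b ρ a_{b'}†`. -/
noncomputable def crossJump {m : ℕ} (b b' : Fin m) (ρ : FockOp m) : FockOp m := fun p q =>
  ((Real.sqrt (p b + 1) : ℝ) : ℂ) * ((Real.sqrt (q b' + 1) : ℝ) : ℂ) *
    ρ (p + Finsupp.single b 1) (q + Finsupp.single b' 1)

/-- `ρ ↦ a_c ρ a_c†`, as a linear map. -/
noncomputable def jump {m : ℕ} (c : Fin m) : Module.End ℂ (FockOp m) where
  toFun := crossJump c c
  map_add' ρ σ := by
    ext p q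
    simp only [crossJump, Matrix.add_apply]
    ring
  map_smul' x ρ := by
    ext p q
    simp only [crossJump, Matrix.smul_apply, smul_eq_mul, RingHom.id_apply]
    ring

theorem jump_apply {m : ℕ} (c : Fin m) (ρ : FockOp m) (p q : Fin m →₀ ℕ) :
    jump c ρ p q = ((Real.sqrt (p c + 1) : ℝ) : ℂ) * ((Real.sqrt (q c + 1) : ℝ) : ℂ) *
      ρ (p + Finsupp.single c 1) (q + Finsupp.single c 1) := rfl

theorem jump_commute {m : ℕ} (i j : Fin m) : Commute (jump i) (jump j) := by
  by_cases hij : i = j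
  · rw [hij]
  refine LinearMap.ext fun ρ => ?_
  ext p q
  simp only [Module.End.mul_apply, jump_apply, Finsupp.add_apply,
    Finsupp.single_eq_of_ne hij, Finsupp.single_eq_of_ne (Ne.symm hij)]
  rw [add_right_comm p, add_right_comm q]
  push_cast
  ring_nf

/-- `gateChannel` as a linear map. -/
noncomputable def gateMap {m : ℕ} (V : Matrix (Fin 2) (Fin 2) ℂ) (i j : Fin m) :
    Module.End ℂ (FockOp m) where
  toFun := gateChannel V i j
  map_add' ρ σ := by
    ext p q
    simp only [gateChannel, Matrix.add_apply, ← Finset.sum_add_distrib]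
    refine Finset.sum_congr rfl fun n _ => Finset.sum_congr rfl fun n' _ => ?_
    ring
  map_smul' x ρ := by
    ext p q
    simp only [gateChannel, Matrix.smul_apply, smul_eq_mul, RingHom.id_apply, Finset.mul_sum]
    refine Finset.sum_congr rfl fun n _ => Finset.sum_congr rfl fun n' _ => ?_
    ring

theorem jump_gateChannel {m : ℕ} (V : Matrix (Fin 2) (Fin 2) ℂ) {i j : Fin m} (hij : i ≠ j)
    (c : Fin m) (ρ : FockOp m) (p q : Fin m →₀ ℕ) :
    jump c (gateChannel V i j ρ) p q = ∑ b, ∑ b',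
      modeMatrix V i j b c * star (modeMatrix V i j b' c) *
        gateChannel V i j (crossJump b b' ρ) p q := by
  have hdeg : ∀ p : Fin m →₀ ℕ, (p + Finsupp.single c 1).degree = p.degree + 1 := by
    intro p; rw [map_add, Finsupp.degree_single]
  rw [jump_apply, gateChannel, hdeg, hdeg]
  -- The annihilated photon is moved from the operator to the amplitudes, so that all `b`, `b'`
  -- share the same summation sectors and `gateAmplitude_lower` applies on both sides of `ρ`.
  have hswap : ∀ b b' : Fin m, gateChannel V i j (crossJump b b' ρ) p q =
      ∑ n ∈ sector m (p.degree + 1), ∑ n' ∈ sector m (q.degree + 1),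
        (((Real.sqrt (n b) : ℝ) : ℂ) * gateAmplitude V i j p (n - Finsupp.single b 1)) * ρ n n' *
          star (((Real.sqrt (n' b') : ℝ) : ℂ) *
            gateAmplitude V i j q (n' - Finsupp.single b' 1)) := by
    intro b b'
    rw [sum_sector_succ _ b _ (by intro n hn; simp [hn])]
    refine Finset.sum_congr rfl fun n _ => ?_
    rw [sum_sector_succ _ b' _ (by intro n hn; simp [hn])]
    refine Finset.sum_congr rfl fun n' _ => ?_
    simp only [crossJump, add_tsub_cancel_right, star_mul', Finsupp.add_apply,
      Finsupp.single_eq_same, Nat.cast_add, Nat.cast_one, Complex.star_def, Complex.conj_ofReal]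
    ring
  simp only [hswap, Finset.mul_sum]
  calc _ = ∑ n ∈ sector m (p.degree + 1), ∑ n' ∈ sector m (q.degree + 1),
        (((Real.sqrt (p c + 1) : ℝ) : ℂ) * gateAmplitude V i j (p + Finsupp.single c 1) n) *
          ρ n n' * star (((Real.sqrt (q c + 1) : ℝ) : ℂ) *
            gateAmplitude V i j (q + Finsupp.single c 1) n') := by
        refine Finset.sum_congr rfl fun n _ => Finset.sum_congr rfl fun n' _ => ?_
        simp only [star_mul', Complex.star_def, Complex.conj_ofReal]
        ring
    _ = ∑ n ∈ sector m (p.degree + 1), ∑ n' ∈ sector m (q.degree + 1), ∑ b, ∑ b',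
        modeMatrix V i j b c * star (modeMatrix V i j b' c) *
        ((((Real.sqrt (n b) : ℝ) : ℂ) * gateAmplitude V i j p (n - Finsupp.single b 1)) * ρ n n' *
          star (((Real.sqrt (n' b') : ℝ) : ℂ) *
            gateAmplitude V i j q (n' - Finsupp.single b' 1))) := by
        refine Finset.sum_congr rfl fun n _ => Finset.sum_congr rfl fun n' _ => ?_
        rw [gateAmplitude_lower V hij, gateAmplitude_lower V hij, star_sum, Finset.sum_mul,
          Finset.sum_mul]
        refine Finset.sum_congr rfl fun b _ => ?_
        rw [Finset.mul_sum]
        refine Finset.sum_congr rfl fun b' _ => ?_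
        simp only [star_mul']
        ring
    _ = _ := by
        simp_rw [Finset.sum_comm (s := sector m (q.degree + 1)) (t := Finset.univ)]
        simp_rw [Finset.sum_comm (s := sector m (p.degree + 1)) (t := Finset.univ)]

/-- The total jump superoperator of a set of modes commutes with a gate acting within or outside
this set. -/
theorem sum_jump_gateChannel {m : ℕ} {V : Matrix (Fin 2) (Fin 2) ℂ} (hV : V * star V = 1)
    {i j : Fin m} (hij : i ≠ j) (S : Finset (Fin m)) (hS : i ∈ S ↔ j ∈ S) :
    Commute (∑ c ∈ S, jump c) (gateMap V i j) := by
  refine LinearMap.ext fun ρ => ?_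
  simp only [Module.End.mul_apply, LinearMap.sum_apply, map_sum]
  ext p q
  simp only [Matrix.sum_apply]
  calc ∑ c ∈ S, jump c (gateChannel V i j ρ) p q
      = ∑ c ∈ S, ∑ b, ∑ b', modeMatrix V i j b c * star (modeMatrix V i j b' c) *
        gateChannel V i j (crossJump b b' ρ) p q :=
        Finset.sum_congr rfl fun c _ => jump_gateChannel V hij c ρ p q
    -- With the sum over `c` innermost, inner products of rows appear, and orthogonality leaves only
    -- the terms with `b = b'` in `S`.
    _ = ∑ b, ∑ b', (∑ c ∈ S, modeMatrix V i j b c * star (modeMatrix V i j b' c)) *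
        gateChannel V i j (crossJump b b' ρ) p q := by
        simp_rw [Finset.sum_comm (s := S) (t := Finset.univ), Finset.sum_mul]
    _ = ∑ b, if b ∈ S then gateChannel V i j (crossJump b b ρ) p q else 0 := by
        refine Finset.sum_congr rfl fun b _ => ?_
        simp only [modeMatrix_orthogonal hV hij S hS]
        rw [Finset.sum_eq_single b]
        · simp
        · intro b' _ hb'
          simp [Ne.symm hb']
        · simp
    _ = _ := by
        rw [← Finset.sum_filter, Finset.filter_mem_eq_inter, Finset.univ_inter]
        rfl

/-- If both modes of the gate have equal weight, the substitution of creation operators preserves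
weighted degree. Taking the indicator function of `S` as weight gives conservation of the photon
number in `S`. -/
theorem gateAmplitude_eq_zero {m : ℕ} (V : Matrix (Fin 2) (Fin 2) ℂ) (i j : Fin m)
    (w : Fin m → ℕ) (hw : w i = w j) {p n : Fin m →₀ ℕ}
    (h : ∑ a, p a * w a ≠ ∑ a, n a * w a) : gateAmplitude V i j p n = 0 := by
  have hX : ∀ a, MvPolynomial.IsWeightedHomogeneous w (creationImage V i j a) (w a) := by
    intro a
    unfold creationImage
    split_ifs with h1 h2
    · subst h1
      exact ((MvPolynomial.isWeightedHomogeneous_X ℂ w a).C_mul _).add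
        (hw ▸ (MvPolynomial.isWeightedHomogeneous_X ℂ w j).C_mul _)
    · subst h2
      exact (hw ▸ (MvPolynomial.isWeightedHomogeneous_X ℂ w i).C_mul _ :
        MvPolynomial.IsWeightedHomogeneous w _ (w a)).add
        ((MvPolynomial.isWeightedHomogeneous_X ℂ w a).C_mul _)
    · exact MvPolynomial.isWeightedHomogeneous_X ℂ w a
  have hP := MvPolynomial.IsWeightedHomogeneous.prod Finset.univ
    (fun a => creationImage V i j a ^ n a) (fun a => n a • w a) (fun a _ => (hX a).pow (n a))
  rw [gateAmplitude, hP.coeff_eq_zero p, mul_zero]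
  rw [Finsupp.weight_apply, Finsupp.sum_fintype _ _ (by simp)]
  simpa using h

/-! ### Positive trace class operators -/

/-- Positive semidefinite operators of finite trace. -/
def IsTraceClass {m : ℕ} (ρ : FockOp m) : Prop :=
  ρ.PosSemidef ∧ Summable fun n => (ρ n n).re

theorem IsState.isTraceClass {m : ℕ} {ρ : FockOp m} (h : IsState ρ) : IsTraceClass ρ :=
  ⟨h.1, Complex.reCLM.summable h.2.summable⟩

/-- The quadratic form is tested only on finitely supported vectors, so positivity can be checked on
finite blocks, where products `B ρ B†` are ordinary matrix products. -/
theorem posSemidef_of_submatrix {ι : Type*} {M : Matrix ι ι ℂ}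
    (h : ∀ s : Finset ι, (M.submatrix ((↑) : s → ι) (↑)).PosSemidef) : M.PosSemidef := by
  classical
  constructor
  · ext a b
    have := congrFun (congrFun (h {a, b}).1 ⟨a, by simp⟩) ⟨b, by simp⟩
    simpa using this
  · intro x
    have := (h x.support).dotProduct_mulVec_nonneg (fun i => x i)
    simp only [dotProduct, Matrix.mulVec, Finset.mul_sum] at this
    rw [Finsupp.sum, ← Finset.sum_coe_sort]
    convert this using 2 with i
    rw [Finsupp.sum, ← Finset.sum_coe_sort]
    simp [mul_assoc]

theorem diag_eq_re {ι : Type*} {M : Matrix ι ι ℂ} (h : M.PosSemidef) (n : ι) :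
    M n n = ((M n n).re : ℂ) ∧ 0 ≤ (M n n).re := by
  have := h.diag_nonneg (i := n)
  rw [Complex.le_def] at this
  exact ⟨Complex.ext (by simp) (by simpa using this.2.symm), by simpa using this.1⟩

/-- The `2 × 2` principal minor gives `|M_pq|² ≤ M_pp M_qq`. The resulting bound by the diagonal is
the source of all absolute convergence below. -/
theorem norm_apply_le {ι : Type*} {M : Matrix ι ι ℂ} (h : M.PosSemidef) (p q : ι) :
    ‖M p q‖ ≤ (M p p).re + (M q q).re := by
  have hd := (h.submatrix ![p, q]).det_nonneg
  obtain ⟨hp, hp0⟩ := diag_eq_re h p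
  obtain ⟨hq, hq0⟩ := diag_eq_re h q
  have hqp : M q p = star (M p q) := (h.1.apply q p).symm
  rw [Matrix.det_fin_two] at hd
  simp only [Matrix.submatrix_apply, Matrix.cons_val_zero, Matrix.cons_val_one] at hd
  rw [hqp, hp, hq, Complex.star_def, Complex.mul_conj, Complex.normSq_eq_norm_sq,
    ← Complex.ofReal_mul, ← Complex.ofReal_sub] at hd
  have hd' : 0 ≤ (M p p).re * (M q q).re - ‖M p q‖ ^ 2 := by exact_mod_cast hd
  nlinarith [norm_nonneg (M p q), mul_nonneg hp0 hq0]

theorem IsTraceClass.summable_comp {m : ℕ} {ρ : FockOp m} (h : IsTraceClass ρ) {ι : Type*}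
    (p q : ι → Fin m →₀ ℕ) (hp : Function.Injective p) (hq : Function.Injective q) :
    Summable fun k => ‖ρ (p k) (q k)‖ :=
  Summable.of_nonneg_of_le (fun _ => norm_nonneg _) (fun k => norm_apply_le h.1 (p k) (q k))
    ((h.2.comp_injective hp).add (h.2.comp_injective hq))

/-! ### Gates preserve positivity and the trace -/

theorem posSemidef_gateChannel {m : ℕ} (V : Matrix (Fin 2) (Fin 2) ℂ) (i j : Fin m)
    {ρ : FockOp m} (h : ρ.PosSemidef) : (gateChannel V i j ρ).PosSemidef := by
  classical
  refine posSemidef_of_submatrix fun s => ?_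
  -- A gate couples only equal photon numbers, so the finite block indexed by `s` depends on `ρ`
  -- only through the sectors that meet `s`.
  let t : Finset (Fin m →₀ ℕ) := s.biUnion fun p => sector m p.degree
  let B : Matrix s t ℂ := fun p n =>
    if (n : Fin m →₀ ℕ).degree = (p : Fin m →₀ ℕ).degree then gateAmplitude V i j p n else 0
  have hB := (h.submatrix ((↑) : t → Fin m →₀ ℕ)).mul_mul_conjTranspose_same B
  have hs : ∀ (p : s) (f : (Fin m →₀ ℕ) → ℂ),
      ∑ n ∈ sector m (p : Fin m →₀ ℕ).degree, f n =
        ∑ n : t, if (n : Fin m →₀ ℕ).degree = (p : Fin m →₀ ℕ).degree then f n else 0 := by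
    intro p f
    rw [Finset.sum_coe_sort t
      (fun n => if n.degree = (p : Fin m →₀ ℕ).degree then f n else 0), ← Finset.sum_filter]
    refine Finset.sum_congr (Finset.ext fun n => ?_) fun _ _ => rfl
    simp only [Finset.mem_filter, t, Finset.mem_biUnion, mem_sector]
    exact ⟨fun hn => ⟨⟨p, p.2, hn⟩, hn⟩, fun hn => hn.2⟩
  convert hB using 1
  ext p q
  rw [Matrix.submatrix_apply, gateChannel, hs, Matrix.mul_apply]
  simp only [Matrix.mul_apply, Finset.sum_mul]
  rw [Finset.sum_comm]
  refine Finset.sum_congr rfl fun n _ => ?_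
  split_ifs with hn
  · rw [hs]
    refine Finset.sum_congr rfl fun n' _ => ?_
    rw [Matrix.conjTranspose_apply]
    simp only [B, Matrix.submatrix_apply, if_pos hn]
    split_ifs <;> simp
  · simp [B, hn]

/-- The trace of the part of an operator with `N` photons. -/
noncomputable def sectorTrace {m : ℕ} (N : ℕ) (ρ : FockOp m) : ℂ := ∑ n ∈ sector m N, ρ n n

/-- By cyclicity the left side is the trace of the total number operator times `ρ`, and that
operator is the scalar `N + 1` on the sector reached. -/
theorem sectorTrace_jump {m : ℕ} (N : ℕ) (ρ : FockOp m) :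
    sectorTrace N ((∑ c, jump c) ρ) = (N + 1) * sectorTrace (N + 1) ρ := by
  have h : ∀ c : Fin m, ∑ n ∈ sector m N, jump c ρ n n =
      ∑ n ∈ sector m (N + 1), (n c : ℂ) * ρ n n := by
    intro c
    rw [sum_sector_succ N c (fun n => (n c : ℂ) * ρ n n) (by intro n hn; simp [hn])]
    refine Finset.sum_congr rfl fun n _ => ?_
    rw [jump_apply, ← Complex.ofReal_mul, Real.mul_self_sqrt (by positivity)]
    simp
  simp only [sectorTrace, LinearMap.sum_apply, Matrix.sum_apply]
  rw [Finset.sum_comm, Finset.sum_congr rfl fun c _ => h c, Finset.sum_comm, Finset.mul_sum]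
  refine Finset.sum_congr rfl fun n hn => ?_
  rw [← Finset.sum_mul, ← Nat.cast_sum, ← Finsupp.degree_eq_sum, mem_sector.1 hn]
  simp

/-- Unitarity on Fock space is not needed: the total jump map commutes with the gate and relates the
trace in sector `N + 1` to the one in sector `N`, so induction reduces the claim to the vacuum. -/
theorem sectorTrace_gateChannel {m : ℕ} {V : Matrix (Fin 2) (Fin 2) ℂ} (hV : V * star V = 1)
    {i j : Fin m} (hij : i ≠ j) (N : ℕ) (ρ : FockOp m) :
    sectorTrace N (gateChannel V i j ρ) = sectorTrace N ρ := by
  induction N generalizing ρ with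
  | zero =>
    have hx : ((Real.sqrt (occFactorial (0 : Fin m →₀ ℕ)) : ℝ) : ℂ) ≠ 0 := by
      have : (0 : ℝ) < occFactorial (0 : Fin m →₀ ℕ) := by exact_mod_cast occFactorial_pos _
      exact_mod_cast Real.sqrt_ne_zero'.2 this
    simp [sectorTrace, gateChannel, gateAmplitude, div_self hx]
  | succ N ih =>
    have h := ih ((∑ c, jump c) ρ)
    have hc := congrArg (fun f => f ρ) (sum_jump_gateChannel hV hij Finset.univ (by simp))
    simp only [Module.End.mul_apply] at hc
    change _ = gateChannel V i j _ at hc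
    rw [← hc, sectorTrace_jump, sectorTrace_jump] at h
    exact mul_left_cancel₀ (by exact_mod_cast N.succ_ne_zero) h

theorem IsTraceClass.gateChannel {m : ℕ} {V : Matrix (Fin 2) (Fin 2) ℂ} (hV : V * star V = 1)
    {i j : Fin m} (hij : i ≠ j) {ρ : FockOp m} (h : IsTraceClass ρ) :
    IsTraceClass (gateChannel V i j ρ) := by
  classical
  have hG := posSemidef_gateChannel V i j h.1
  refine ⟨hG, summable_of_sum_le (c := ∑' n, (ρ n n).re) (fun n => (diag_eq_re hG n).2) fun s => ?_⟩
  have hsec : ∀ N, ∑ n ∈ sector m N, (LossyOptics.gateChannel V i j ρ n n).re =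
      ∑ n ∈ sector m N, (ρ n n).re := by
    intro N
    have := congrArg Complex.re (sectorTrace_gateChannel hV hij N ρ)
    simpa only [sectorTrace, Complex.re_sum] using this
  let K := s.image Finsupp.degree
  have hdisj : (K : Set ℕ).PairwiseDisjoint (sector m) := by
    intro a _ b _ hab
    rw [Function.onFun, Finset.disjoint_left]
    intro n hn hn'
    exact hab ((mem_sector.1 hn).symm.trans (mem_sector.1 hn'))
  -- Only sums over whole sectors are preserved, so the finite set is first enlarged to a union of
  -- sectors; positivity of the diagonal allows this.
  calc ∑ n ∈ s, (LossyOptics.gateChannel V i j ρ n n).re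
      ≤ ∑ n ∈ K.biUnion (sector m), (LossyOptics.gateChannel V i j ρ n n).re := by
        refine Finset.sum_le_sum_of_subset_of_nonneg ?_ fun n _ _ => (diag_eq_re hG n).2
        intro n hn
        rw [Finset.mem_biUnion]
        exact ⟨n.degree, Finset.mem_image_of_mem _ hn, mem_sector.2 rfl⟩
    _ = ∑ n ∈ K.biUnion (sector m), (ρ n n).re := by
        rw [Finset.sum_biUnion hdisj, Finset.sum_biUnion hdisj]
        exact Finset.sum_congr rfl fun N _ => hsec N
    _ ≤ _ := h.2.sum_le_tsum _ fun n _ => (diag_eq_re h.1 n).2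

/-! ### Loss elements preserve positivity and the trace -/

theorem binomial_term_le_one {η : ℝ} (h0 : 0 ≤ η) (h1 : η ≤ 1) (n k : ℕ) :
    ((n + k).choose k : ℝ) * η ^ n * (1 - η) ^ k ≤ 1 := by
  have h2 : 0 ≤ 1 - η := by linarith
  have h := add_pow (1 - η) η (n + k)
  rw [sub_add_cancel, one_pow] at h
  refine (le_of_eq_of_le ?_ (Finset.single_le_sum (f := fun l =>
    (1 - η) ^ l * η ^ (n + k - l) * ((n + k).choose l : ℝ)) (fun l _ => by positivity)
    (Finset.mem_range.2 (by omega : k < n + k + 1)))).trans h.ge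
  simp only [Nat.add_sub_cancel]
  ring

theorem norm_lossAmplitude_le_one {m : ℕ} {η : ℝ} (h0 : 0 ≤ η) (h1 : η ≤ 1) (i : Fin m) (k : ℕ)
    (n : Fin m →₀ ℕ) : ‖lossAmplitude η i k n‖ ≤ 1 := by
  rw [lossAmplitude, Complex.norm_real, Real.norm_of_nonneg (Real.sqrt_nonneg _)]
  exact Real.sqrt_le_one.2 (binomial_term_le_one h0 h1 _ _)

theorem star_lossAmplitude {m : ℕ} (η : ℝ) (i : Fin m) (k : ℕ) (n : Fin m →₀ ℕ) :
    star (lossAmplitude η i k n) = lossAmplitude η i k n := by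
  rw [lossAmplitude, Complex.star_def, Complex.conj_ofReal]

/-- The term `K_k ρ K_k†` of a loss element. -/
noncomputable def lossTerm {m : ℕ} (η : ℝ) (i : Fin m) (k : ℕ) (ρ : FockOp m) : FockOp m :=
  fun p q => lossAmplitude η i k p *
    ρ (p + Finsupp.single i k) (q + Finsupp.single i k) * lossAmplitude η i k q

theorem lossChannel_apply {m : ℕ} (η : ℝ) (i : Fin m) (ρ : FockOp m) (p q : Fin m →₀ ℕ) :
    lossChannel η i ρ p q = ∑' k, lossTerm η i k ρ p q := by
  simp only [lossChannel, lossTerm, star_lossAmplitude]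

theorem norm_lossTerm_le {m : ℕ} {η : ℝ} (h0 : 0 ≤ η) (h1 : η ≤ 1) (i : Fin m) (k : ℕ)
    (ρ : FockOp m) (p q : Fin m →₀ ℕ) :
    ‖lossTerm η i k ρ p q‖ ≤ ‖ρ (p + Finsupp.single i k) (q + Finsupp.single i k)‖ := by
  rw [lossTerm, norm_mul, norm_mul]
  have hp := norm_lossAmplitude_le_one h0 h1 i k p
  have hq := norm_lossAmplitude_le_one h0 h1 i k q
  calc _ ≤ 1 * ‖ρ (p + Finsupp.single i k) (q + Finsupp.single i k)‖ * 1 := by gcongr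
    _ = _ := by ring

theorem add_single_injective {m : ℕ} (i : Fin m) (p : Fin m →₀ ℕ) :
    Function.Injective fun k : ℕ => p + Finsupp.single i k := fun _ _ h =>
  Finsupp.single_injective i (add_left_cancel h)

theorem IsTraceClass.summable_lossTerm {m : ℕ} {η : ℝ} (h0 : 0 ≤ η) (h1 : η ≤ 1) (i : Fin m)
    {ρ : FockOp m} (h : IsTraceClass ρ) (p q : Fin m →₀ ℕ) :
    Summable fun k => lossTerm η i k ρ p q :=
  Summable.of_norm_bounded
    (h.summable_comp _ _ (add_single_injective i p) (add_single_injective i q))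
    fun k => norm_lossTerm_le h0 h1 i k ρ p q

theorem posSemidef_lossTerm {m : ℕ} (η : ℝ) (i : Fin m) (k : ℕ) {ρ : FockOp m}
    (h : ρ.PosSemidef) : (lossTerm η i k ρ).PosSemidef := by
  classical
  refine posSemidef_of_submatrix fun s => ?_
  have hB := (h.submatrix (fun p : s => (p : Fin m →₀ ℕ) + Finsupp.single i k)
    ).mul_mul_conjTranspose_same (Matrix.diagonal fun p : s => lossAmplitude η i k p)
  convert hB using 1
  ext p q
  rw [Matrix.diagonal_conjTranspose, Matrix.mul_diagonal, Matrix.diagonal_mul, Pi.star_apply,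
    star_lossAmplitude]
  rfl

/-- Reindexed by the occupation `P = p + k e_i` before the loss, the weights for fixed `P` form a
binomial distribution of total mass one, so summing over `k` first returns `r P`. -/
theorem summable_loss_diag {m : ℕ} {η : ℝ} (h0 : 0 ≤ η) (h1 : η ≤ 1) (i : Fin m)
    {r : (Fin m →₀ ℕ) → ℝ} (hr : ∀ n, 0 ≤ r n) (hs : Summable r) :
    Summable fun x : (Fin m →₀ ℕ) × ℕ => ((x.1 i + x.2).choose x.2 : ℝ) * η ^ x.1 i *
      (1 - η) ^ x.2 * r (x.1 + Finsupp.single i x.2) := by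
  have h2 : 0 ≤ 1 - η := by linarith
  let G : (Fin m →₀ ℕ) × ℕ → ℝ := fun x =>
    (1 - η) ^ x.2 * η ^ (x.1 i - x.2) * ((x.1 i).choose x.2 : ℝ) * r x.1
  have hsum : ∀ P, HasSum (fun k => G (P, k)) (r P) := by
    intro P
    have h := add_pow (1 - η) η (P i)
    rw [sub_add_cancel, one_pow] at h
    have : r P = ∑ k ∈ Finset.range (P i + 1), G (P, k) := by
      simp only [G]
      rw [← Finset.sum_mul, ← h, one_mul]
    rw [this]
    refine hasSum_sum_of_ne_finset_zero fun k hk => ?_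
    rw [Finset.mem_range, not_lt] at hk
    simp only [G]
    rw [Nat.choose_eq_zero_of_lt (by omega)]
    simp
  have hG : Summable G := by
    rw [summable_prod_of_nonneg fun x => mul_nonneg (by positivity) (hr _)]
    exact ⟨fun P => (hsum P).summable, hs.congr fun P => (hsum P).tsum_eq.symm⟩
  have hinj : Function.Injective
      fun x : (Fin m →₀ ℕ) × ℕ => (x.1 + Finsupp.single i x.2, x.2) := by
    rintro ⟨p, k⟩ ⟨p', k'⟩ h
    simp only [Prod.mk.injEq] at h
    obtain ⟨h, rfl⟩ := h
    rw [add_right_cancel h]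
  refine (hG.comp_injective hinj).congr fun x => ?_
  simp only [G, Function.comp_apply, Finsupp.add_apply, Finsupp.single_eq_same,
    Nat.add_sub_cancel]
  ring

theorem IsTraceClass.lossChannel {m : ℕ} {η : ℝ} (h0 : 0 ≤ η) (h1 : η ≤ 1) (i : Fin m)
    {ρ : FockOp m} (h : IsTraceClass ρ) : IsTraceClass (lossChannel η i ρ) := by
  classical
  have h2 : 0 ≤ 1 - η := by linarith
  have hs : ∀ p q, HasSum (fun k => lossTerm η i k ρ p q) (LossyOptics.lossChannel η i ρ p q) := by
    intro p q
    rw [lossChannel_apply]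
    exact (h.summable_lossTerm h0 h1 i p q).hasSum
  have hpos : (LossyOptics.lossChannel η i ρ).PosSemidef := by
    constructor
    · ext p q
      rw [Matrix.conjTranspose_apply]
      have := (hs q p).star
      simp only [(posSemidef_lossTerm η i _ h.1).1.apply p q] at this
      exact this.unique (hs p q)
    · intro x
      have : HasSum (fun k => x.sum fun p xp => x.sum fun q xq =>
          star xp * lossTerm η i k ρ p q * xq)
          (x.sum fun p xp => x.sum fun q xq =>
            star xp * LossyOptics.lossChannel η i ρ p q * xq) :=
        hasSum_sum fun p _ => hasSum_sum fun q _ => ((hs p q).mul_left _).mul_right _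
      exact this.nonneg fun k => (posSemidef_lossTerm η i k h.1).2 x
  refine ⟨hpos, ?_⟩
  have hd := summable_loss_diag h0 h1 i (fun n => (diag_eq_re h.1 n).2) h.2
  refine hd.prod.congr fun p => ?_
  rw [← (Complex.hasSum_re (hs p p)).tsum_eq]
  refine tsum_congr fun k => ?_
  rw [lossTerm, mul_right_comm (lossAmplitude η i k p), lossAmplitude, ← Complex.ofReal_mul,
    Real.mul_self_sqrt (by positivity), Complex.re_ofReal_mul]

/-! ### Double series -/

theorem hasSum_antidiagonal {f : ℕ × ℕ → ℂ} {a : ℂ} (h : HasSum f a) :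
    HasSum (fun d => ∑ x ∈ Finset.HasAntidiagonal.antidiagonal d, f x) a := by
  have h1 := Finset.HasAntidiagonal.sigmaAntidiagonalEquivProd.hasSum_iff.2 h
  refine h1.sigma fun d => ?_
  exact Finset.hasSum (Finset.HasAntidiagonal.antidiagonal d) f

theorem summable_of_antidiagonal {f : ℕ × ℕ → ℂ}
    (h : Summable fun d => ∑ x ∈ Finset.HasAntidiagonal.antidiagonal d, ‖f x‖) : Summable f := by
  refine Summable.of_norm ?_
  refine Finset.HasAntidiagonal.sigmaAntidiagonalEquivProd.summable_iff.1
    ((summable_sigma_of_nonneg fun y => norm_nonneg _).2 ⟨fun d =>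
      (Finset.hasSum (Finset.HasAntidiagonal.antidiagonal d) fun x => ‖f x‖).summable, ?_⟩)
  refine h.congr fun d => ?_
  exact (Finset.hasSum (Finset.HasAntidiagonal.antidiagonal d) fun x => ‖f x‖).tsum_eq.symm

theorem lossChannel_comp_hasSum {m : ℕ} {η₁ η₂ : ℝ} (i j : Fin m) (ρ : FockOp m)
    (p q : Fin m →₀ ℕ)
    (h : Summable fun x : ℕ × ℕ => lossTerm η₁ i x.1 (lossTerm η₂ j x.2 ρ) p q) :
    HasSum (fun x : ℕ × ℕ => lossTerm η₁ i x.1 (lossTerm η₂ j x.2 ρ) p q)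
      (lossChannel η₁ i (lossChannel η₂ j ρ) p q) := by
  convert h.hasSum
  rw [h.tsum_prod, lossChannel_apply]
  refine tsum_congr fun k => ?_
  rw [lossTerm, lossChannel_apply, ← tsum_mul_left, ← tsum_mul_right]
  rfl

/-! ### Loss elements in different modes -/

theorem lossTerm_comm {m : ℕ} {η₁ η₂ : ℝ} {i j : Fin m} (hij : i ≠ j) (k l : ℕ) (ρ : FockOp m) :
    lossTerm η₁ i k (lossTerm η₂ j l ρ) = lossTerm η₂ j l (lossTerm η₁ i k ρ) := by
  ext p q
  simp only [lossTerm, lossAmplitude, Finsupp.add_apply, Finsupp.single_eq_of_ne hij,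
    Finsupp.single_eq_of_ne hij.symm, add_zero]
  rw [add_right_comm p, add_right_comm q]
  ring_nf

/-- Distinctness of the modes makes `(k, l) ↦ p + k e_i + l e_j` injective, so the trace bounds the
double series. In a single mode injectivity fails, and `lossChannel_lossChannel` has to group by `k
+ l` instead. -/
theorem IsTraceClass.summable_lossTerm_lossTerm {m : ℕ} {η₁ η₂ : ℝ} (h₁ : 0 ≤ η₁ ∧ η₁ ≤ 1)
    (h₂ : 0 ≤ η₂ ∧ η₂ ≤ 1) {i j : Fin m} (hij : i ≠ j) {ρ : FockOp m} (h : IsTraceClass ρ)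
    (p q : Fin m →₀ ℕ) :
    Summable fun x : ℕ × ℕ => lossTerm η₁ i x.1 (lossTerm η₂ j x.2 ρ) p q := by
  have hinj : ∀ p : Fin m →₀ ℕ, Function.Injective
      fun x : ℕ × ℕ => p + Finsupp.single i x.1 + Finsupp.single j x.2 := by
    rintro p ⟨k, l⟩ ⟨k', l'⟩ he
    have hi := DFunLike.congr_fun he i
    have hj := DFunLike.congr_fun he j
    simp [Finsupp.single_eq_of_ne hij, Finsupp.single_eq_of_ne hij.symm] at hi hj
    rw [hi, hj]
  exact Summable.of_norm_bounded (h.summable_comp _ _ (hinj p) (hinj q)) fun x =>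
    (norm_lossTerm_le h₁.1 h₁.2 i _ _ p q).trans (norm_lossTerm_le h₂.1 h₂.2 j _ _ _ _)

theorem lossChannel_comm {m : ℕ} {η₁ η₂ : ℝ} (h₁ : 0 ≤ η₁ ∧ η₁ ≤ 1)
    (h₂ : 0 ≤ η₂ ∧ η₂ ≤ 1) {i j : Fin m} (hij : i ≠ j) {ρ : FockOp m} (h : IsTraceClass ρ) :
    lossChannel η₁ i (lossChannel η₂ j ρ) = lossChannel η₂ j (lossChannel η₁ i ρ) := by
  ext p q
  have hs := lossChannel_comp_hasSum i j ρ p q (h.summable_lossTerm_lossTerm h₁ h₂ hij p q)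
  have hs' := lossChannel_comp_hasSum j i ρ p q
    (h.summable_lossTerm_lossTerm h₂ h₁ hij.symm p q)
  refine hs.unique ?_
  rw [← (Equiv.prodComm ℕ ℕ).hasSum_iff] at hs'
  refine hs'.congr_fun fun x => ?_
  rw [lossTerm_comm hij]
  rfl

/-! ### Loss elements in the same mode -/

/-- Apart from a factor depending only on `k + l`, the product is the root of a binomial weight in
`(k, l)`. The first factor is the same in kets and bras up to exchanging `p` and `q`, and the second
does not involve `p` at all. -/
theorem lossAmplitude_mul {m : ℕ} {η₁ η₂ : ℝ} (h₁ : 0 ≤ η₁ ∧ η₁ ≤ 1) (h₂ : 0 ≤ η₂ ∧ η₂ ≤ 1)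
    (i : Fin m) (k l : ℕ) (p : Fin m →₀ ℕ) :
    lossAmplitude η₁ i k p * lossAmplitude η₂ i l (p + Finsupp.single i k) =
      ((Real.sqrt ((p i + (k + l)).choose (k + l) * (η₁ * η₂) ^ p i) : ℝ) : ℂ) *
        ((Real.sqrt ((k + l).choose k * (((1 - η₁) * η₂) ^ k * (1 - η₂) ^ l)) : ℝ) : ℂ) := by
  have h1 : 0 ≤ 1 - η₁ := by linarith [h₁.2]
  have h2 : 0 ≤ 1 - η₂ := by linarith [h₂.2]
  have h3 := h₁.1
  have h4 := h₂.1
  rw [lossAmplitude, lossAmplitude, ← Complex.ofReal_mul, ← Complex.ofReal_mul,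
    ← Real.sqrt_mul (by positivity), ← Real.sqrt_mul (by positivity)]
  congr 2
  simp only [Finsupp.add_apply, Finsupp.single_eq_same]
  have hc : (p i + k).choose k * (p i + k + l).choose l =
      (p i + (k + l)).choose (k + l) * (k + l).choose k := by
    have := Nat.choose_mul (n := p i + (k + l)) (k := k + l) (s := l) (by omega)
    rw [show p i + (k + l) - l = p i + k by omega, Nat.add_sub_cancel] at this
    rw [Nat.choose_symm_add (a := k) (b := l), this, mul_comm, add_assoc]
  have hc' : ((p i + k).choose k : ℝ) * (p i + k + l).choose l =
      (p i + (k + l)).choose (k + l) * (k + l).choose k := by exact_mod_cast hc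
  rw [pow_add, mul_pow, mul_pow]
  linear_combination (η₁ ^ p i * (1 - η₁) ^ k * η₂ ^ p i * η₂ ^ k * (1 - η₂) ^ l) * hc'

theorem lossChannel_lossChannel {m : ℕ} {η₁ η₂ : ℝ} (h₁ : 0 ≤ η₁ ∧ η₁ ≤ 1)
    (h₂ : 0 ≤ η₂ ∧ η₂ ≤ 1) (i : Fin m) {ρ : FockOp m} (h : IsTraceClass ρ) :
    lossChannel η₁ i (lossChannel η₂ i ρ) = lossChannel (η₁ * η₂) i ρ := by
  have h1 : 0 ≤ 1 - η₁ := by linarith [h₁.2]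
  have h2 : 0 ≤ 1 - η₂ := by linarith [h₂.2]
  have h3 := h₁.1
  have h4 := h₂.1
  have h0 : 0 ≤ η₁ * η₂ := by positivity
  have h5 : η₁ * η₂ ≤ 1 := mul_le_one₀ h₁.2 h4 h₂.2
  ext p q
  -- The weight for splitting the lost photons between the two elements: a photon passes the first
  -- and is lost in the second with probability `(1 - η₁) η₂`, or is lost in the first with
  -- probability `1 - η₂`. These add up to `1 - η₁ η₂`.
  let w : ℕ × ℕ → ℝ := fun x =>
    (x.1 + x.2).choose x.1 * (((1 - η₁) * η₂) ^ x.1 * (1 - η₂) ^ x.2)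
  have hw0 : ∀ x, 0 ≤ w x := fun x => by positivity
  let A : ℕ → ℂ := fun d =>
    ((Real.sqrt ((p i + d).choose d * (η₁ * η₂) ^ p i) : ℝ) : ℂ) *
      ρ (p + Finsupp.single i d) (q + Finsupp.single i d) *
      ((Real.sqrt ((q i + d).choose d * (η₁ * η₂) ^ q i) : ℝ) : ℂ)
  have hterm : ∀ x : ℕ × ℕ, lossTerm η₁ i x.1 (lossTerm η₂ i x.2 ρ) p q =
      A (x.1 + x.2) * (w x : ℂ) := by
    intro x
    have hp := lossAmplitude_mul h₁ h₂ i x.1 x.2 p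
    have hq := lossAmplitude_mul h₁ h₂ i x.1 x.2 q
    have hw : (w x : ℂ) = ((Real.sqrt (w x) : ℝ) : ℂ) * ((Real.sqrt (w x) : ℝ) : ℂ) := by
      rw [← Complex.ofReal_mul, Real.mul_self_sqrt (hw0 x)]
    rw [hw]
    simp only [lossTerm, A]
    rw [add_assoc p, ← Finsupp.single_add, add_assoc q, ← Finsupp.single_add]
    calc _ = (lossAmplitude η₁ i x.1 p * lossAmplitude η₂ i x.2 (p + Finsupp.single i x.1)) *
          ρ (p + Finsupp.single i (x.1 + x.2)) (q + Finsupp.single i (x.1 + x.2)) *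
          (lossAmplitude η₁ i x.1 q * lossAmplitude η₂ i x.2 (q + Finsupp.single i x.1)) := by ring
      _ = _ := by
        rw [hp, hq]
        ring
  have hwsum : ∀ d, ∑ x ∈ Finset.HasAntidiagonal.antidiagonal d, w x = (1 - η₁ * η₂) ^ d := by
    intro d
    rw [show 1 - η₁ * η₂ = (1 - η₁) * η₂ + (1 - η₂) by ring, (Commute.all _ _).add_pow']
    refine Finset.sum_congr rfl fun x hx => ?_
    rw [nsmul_eq_mul, ← Finset.HasAntidiagonal.mem_antidiagonal.1 hx]
  have hA : ∀ d, A d * (((1 - η₁ * η₂) ^ d : ℝ) : ℂ) = lossTerm (η₁ * η₂) i d ρ p q := by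
    intro d
    have h6 : 0 ≤ 1 - η₁ * η₂ := by linarith
    have h7 : (((1 - η₁ * η₂) ^ d : ℝ) : ℂ) = ((Real.sqrt ((1 - η₁ * η₂) ^ d) : ℝ) : ℂ) *
        ((Real.sqrt ((1 - η₁ * η₂) ^ d) : ℝ) : ℂ) := by
      rw [← Complex.ofReal_mul, Real.mul_self_sqrt (by positivity)]
    rw [h7, lossTerm, lossAmplitude, lossAmplitude,
      Real.sqrt_mul (by positivity : 0 ≤ ((p i + d).choose d : ℝ) * (η₁ * η₂) ^ p i),
      Real.sqrt_mul (by positivity : 0 ≤ ((q i + d).choose d : ℝ) * (η₁ * η₂) ^ q i)]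
    simp only [A, Complex.ofReal_mul]
    ring
  clear_value A
  -- On each antidiagonal the terms are nonnegative multiples of one number, so their norms add up
  -- exactly to the norm of the single loss term for `η₁ * η₂`.
  have hsum : Summable fun x : ℕ × ℕ => lossTerm η₁ i x.1 (lossTerm η₂ i x.2 ρ) p q := by
    refine summable_of_antidiagonal ?_
    refine (h.summable_lossTerm h0 h5 i p q).norm.congr fun d => ?_
    rw [← hA, norm_mul, Complex.norm_real, Real.norm_of_nonneg (by
      have : 0 ≤ 1 - η₁ * η₂ := by linarith
      positivity), ← hwsum, Finset.mul_sum]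
    refine Finset.sum_congr rfl fun x hx => ?_
    rw [hterm, norm_mul, Complex.norm_real, Real.norm_of_nonneg (hw0 x),
      Finset.HasAntidiagonal.mem_antidiagonal.1 hx]
  have := hasSum_antidiagonal (lossChannel_comp_hasSum i i ρ p q hsum)
  rw [← this.tsum_eq, lossChannel_apply]
  refine tsum_congr fun d => ?_
  rw [← hA, ← hwsum, Complex.ofReal_sum, Finset.mul_sum]
  refine Finset.sum_congr rfl fun x hx => ?_
  rw [hterm, Finset.HasAntidiagonal.mem_antidiagonal.1 hx]

theorem lossChannel_one {m : ℕ} (i : Fin m) (ρ : FockOp m) : lossChannel 1 i ρ = ρ := by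
  ext p q
  rw [lossChannel_apply, tsum_eq_single 0]
  · simp [lossTerm, lossAmplitude]
  · intro k hk
    simp [lossTerm, lossAmplitude, hk]

/-! ### Loss elements and gates -/

theorem jump_pow_apply {m : ℕ} (i : Fin m) (k : ℕ) (ρ : FockOp m) (p q : Fin m →₀ ℕ) :
    (jump i ^ k) ρ p q = ((Real.sqrt ((p i + 1).ascFactorial k) : ℝ) : ℂ) *
      ((Real.sqrt ((q i + 1).ascFactorial k) : ℝ) : ℂ) *
        ρ (p + Finsupp.single i k) (q + Finsupp.single i k) := by
  induction k generalizing ρ with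
  | zero => simp
  | succ k ih =>
    rw [pow_succ, Module.End.mul_apply, ih, jump_apply, Nat.ascFactorial_succ,
      Nat.ascFactorial_succ, Nat.cast_mul, Nat.cast_mul, Real.sqrt_mul (by positivity),
      Real.sqrt_mul (by positivity), Finsupp.single_add, add_assoc p, add_assoc q]
    simp only [Finsupp.add_apply, Finsupp.single_eq_same]
    rw [show (((p i + k : ℕ) : ℝ) + 1) = ((p i + 1 + k : ℕ) : ℝ) by push_cast; ring,
      show (((q i + k : ℕ) : ℝ) + 1) = ((q i + 1 + k : ℕ) : ℝ) by push_cast; ring]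
    push_cast
    ring

/-- The contribution of the loss of `d` photons to the channel of losses in the modes `S`. -/
noncomputable def jumpTerm {m : ℕ} (η : ℝ) (S : Finset (Fin m)) (d : ℕ) (ρ : FockOp m) :
    FockOp m := fun p q =>
  ((Real.sqrt η ^ (∑ c ∈ S, p c) : ℝ) : ℂ) * ((Real.sqrt η ^ (∑ c ∈ S, q c) : ℝ) : ℂ) *
    (((1 - η) ^ d / d.factorial : ℝ) : ℂ) * ((∑ c ∈ S, jump c) ^ d) ρ p q

theorem sqrt_pow_eq {x : ℝ} (hx : 0 ≤ x) (n : ℕ) : Real.sqrt x ^ n = Real.sqrt (x ^ n) := by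
  rw [← Real.sqrt_sq (pow_nonneg (Real.sqrt_nonneg x) n), ← pow_mul, mul_comm, pow_mul,
    Real.sq_sqrt hx]

theorem lossAmplitude_eq {m : ℕ} {η : ℝ} (h0 : 0 ≤ η) (h1 : η ≤ 1) (i : Fin m) (k : ℕ)
    (p : Fin m →₀ ℕ) : lossAmplitude η i k p =
      ((Real.sqrt η ^ p i : ℝ) : ℂ) * ((Real.sqrt ((p i + 1).ascFactorial k) : ℝ) : ℂ) *
        ((Real.sqrt ((1 - η) ^ k / k.factorial) : ℝ) : ℂ) := by
  have h2 : 0 ≤ 1 - η := by linarith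
  rw [lossAmplitude, ← Complex.ofReal_mul, ← Complex.ofReal_mul, sqrt_pow_eq h0,
    ← Real.sqrt_mul (by positivity), ← Real.sqrt_mul (by positivity)]
  congr 2
  rw [Nat.ascFactorial_eq_factorial_mul_choose]
  have : (k.factorial : ℝ) ≠ 0 := by positivity
  push_cast
  field_simp

/-- Separates a Kraus term into damping by `√η` per surviving photon and a power of the jump map,
the two ingredients that can be compared with a gate. -/
theorem lossTerm_eq {m : ℕ} {η : ℝ} (h0 : 0 ≤ η) (h1 : η ≤ 1) (i : Fin m) (k : ℕ)
    (ρ : FockOp m) (p q : Fin m →₀ ℕ) : lossTerm η i k ρ p q =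
      ((Real.sqrt η ^ p i : ℝ) : ℂ) * ((Real.sqrt η ^ q i : ℝ) : ℂ) *
        (((1 - η) ^ k / k.factorial : ℝ) : ℂ) * (jump i ^ k) ρ p q := by
  have h2 : 0 ≤ 1 - η := by linarith
  have h3 : (((1 - η) ^ k / k.factorial : ℝ) : ℂ) =
      ((Real.sqrt ((1 - η) ^ k / k.factorial) : ℝ) : ℂ) *
        ((Real.sqrt ((1 - η) ^ k / k.factorial) : ℝ) : ℂ) := by
    rw [← Complex.ofReal_mul, Real.mul_self_sqrt (by positivity)]
  rw [lossTerm, lossAmplitude_eq h0 h1, lossAmplitude_eq h0 h1, jump_pow_apply, h3]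
  ring

theorem IsTraceClass.hasSum_jumpTerm_single {m : ℕ} {η : ℝ} (h0 : 0 ≤ η) (h1 : η ≤ 1)
    (i : Fin m) {ρ : FockOp m} (h : IsTraceClass ρ) (p q : Fin m →₀ ℕ) :
    HasSum (fun d => jumpTerm η {i} d ρ p q) (LossyOptics.lossChannel η i ρ p q) := by
  have := (h.summable_lossTerm h0 h1 i p q).hasSum
  rw [← lossChannel_apply] at this
  refine this.congr_fun fun d => ?_
  rw [lossTerm_eq h0 h1, jumpTerm]
  simp only [Finset.sum_singleton]

theorem IsTraceClass.hasSum_jumpTerm_pair {m : ℕ} {η : ℝ} (h0 : 0 ≤ η) (h1 : η ≤ 1)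
    {i j : Fin m} (hij : i ≠ j) {ρ : FockOp m} (h : IsTraceClass ρ) (p q : Fin m →₀ ℕ) :
    HasSum (fun d => jumpTerm η {i, j} d ρ p q)
      (LossyOptics.lossChannel η i (LossyOptics.lossChannel η j ρ) p q) := by
  have := hasSum_antidiagonal (lossChannel_comp_hasSum i j ρ p q
    (h.summable_lossTerm_lossTerm ⟨h0, h1⟩ ⟨h0, h1⟩ hij p q))
  refine this.congr_fun fun d => ?_
  -- The jump maps of the two modes commute, so the binomial theorem applies. Its coefficients turn
  -- `1 / d!` into the product of the two factorial denominators (`hf` below).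
  have hpow : ((jump i + jump j) ^ d) ρ p q =
      ∑ x ∈ Finset.HasAntidiagonal.antidiagonal d, (d.choose x.1 : ℂ) * (jump i ^ x.1) ((jump j ^ x.2) ρ) p q := by
    rw [(jump_commute i j).add_pow', LinearMap.sum_apply, Matrix.sum_apply]
    refine Finset.sum_congr rfl fun x _ => ?_
    simp [Module.End.mul_apply]
  rw [jumpTerm, Finset.sum_pair hij, Finset.sum_pair hij, Finset.sum_pair hij, hpow,
    Finset.mul_sum]
  refine Finset.sum_congr rfl fun x hx => ?_
  have hd := Finset.HasAntidiagonal.mem_antidiagonal.1 hx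
  rw [lossTerm_eq h0 h1, jump_pow_apply i x.1 ((jump j ^ x.2) ρ),
    jump_pow_apply i x.1 (lossTerm η j x.2 ρ), lossTerm_eq h0 h1]
  simp only [Finsupp.add_apply, Finsupp.single_eq_of_ne hij.symm, add_zero]
  have hf : (((1 - η) ^ d / d.factorial : ℝ) : ℂ) * (d.choose x.1 : ℂ) =
      (((1 - η) ^ x.1 / x.1.factorial : ℝ) : ℂ) * (((1 - η) ^ x.2 / x.2.factorial : ℝ) : ℂ) := by
    rw [← Complex.ofReal_natCast, ← Complex.ofReal_mul, ← Complex.ofReal_mul]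
    congr 1
    subst hd
    rw [Nat.choose_symm_add, Nat.add_choose, Nat.cast_div (Nat.factorial_mul_factorial_dvd_factorial_add _ _)
      (by positivity)]
    have h2 : ((x.1 + x.2).factorial : ℝ) ≠ 0 := by positivity
    push_cast
    rw [pow_add]
    field_simp
  rw [pow_add, pow_add]
  simp only [Complex.ofReal_mul]
  linear_combination (((Real.sqrt η ^ p i : ℝ) : ℂ) * ((Real.sqrt η ^ p j : ℝ) : ℂ) *
    ((Real.sqrt η ^ q i : ℝ) : ℂ) * ((Real.sqrt η ^ q j : ℝ) : ℂ) *
    (((Real.sqrt ((p i + 1).ascFactorial x.1) : ℝ) : ℂ) *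
      ((Real.sqrt ((q i + 1).ascFactorial x.1) : ℝ) : ℂ) *
        (jump j ^ x.2) ρ (p + Finsupp.single i x.1) (q + Finsupp.single i x.1))) * hf

theorem gateChannel_jumpTerm {m : ℕ} {V : Matrix (Fin 2) (Fin 2) ℂ} (hV : V * star V = 1)
    {i j : Fin m} (hij : i ≠ j) {S : Finset (Fin m)} (hS : i ∈ S ↔ j ∈ S) (η : ℝ) (d : ℕ)
    (ρ : FockOp m) :
    gateChannel V i j (jumpTerm η S d ρ) = jumpTerm η S d (gateChannel V i j ρ) := by
  classical
  have hc := congrArg (fun f => f ρ) ((sum_jump_gateChannel hV hij S hS).pow_left d)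
  simp only [Module.End.mul_apply] at hc
  change (((∑ c ∈ S, jump c) ^ d) (gateChannel V i j ρ)) =
    gateChannel V i j (((∑ c ∈ S, jump c) ^ d) ρ) at hc
  ext p q
  rw [jumpTerm, hc, gateChannel, gateChannel, Finset.mul_sum]
  refine Finset.sum_congr rfl fun n _ => ?_
  rw [Finset.mul_sum]
  refine Finset.sum_congr rfl fun n' _ => ?_
  -- Wherever the gate has a nonzero amplitude the photon numbers in `S` agree, so the damping
  -- factors pass through it.
  have hz : ∀ p n : Fin m →₀ ℕ, gateAmplitude V i j p n ≠ 0 → ∑ c ∈ S, p c = ∑ c ∈ S, n c := by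
    intro p n hne
    by_contra hne'
    refine hne (gateAmplitude_eq_zero V i j (fun c => if c ∈ S then 1 else 0) (by simp [hS]) ?_)
    simpa using hne'
  by_cases h1 : gateAmplitude V i j p n = 0
  · simp [h1]
  by_cases h2 : gateAmplitude V i j q n' = 0
  · simp [h2]
  rw [jumpTerm, hz p n h1, hz q n' h2]
  ring

/-- A gate has finite sums in each matrix element, so it passes through the series term by term. The
cases needed are a loss in a spectator mode and a pair of losses in both arms. -/
theorem gateChannel_comm_of_hasSum_jumpTerm {m : ℕ} {V : Matrix (Fin 2) (Fin 2) ℂ}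
    (hV : V * star V = 1) {i j : Fin m} (hij : i ≠ j) {S : Finset (Fin m)} (hS : i ∈ S ↔ j ∈ S)
    (η : ℝ) (L : FockOp m → FockOp m)
    (hL : ∀ ρ, IsTraceClass ρ → ∀ p q, HasSum (fun d => jumpTerm η S d ρ p q) (L ρ p q))
    {ρ : FockOp m} (h : IsTraceClass ρ) :
    L (gateChannel V i j ρ) = gateChannel V i j (L ρ) := by
  ext p q
  refine (hL _ (h.gateChannel hV hij) p q).unique ?_
  simp only [← gateChannel_jumpTerm hV hij hS]
  exact hasSum_sum fun n _ => hasSum_sum fun n' _ => ((hL ρ h n n').mul_left _).mul_right _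

/-! ### Channels of networks -/

theorem unitary_mul_star (U : Matrix.unitaryGroup (Fin 2) ℂ) :
    (U : Matrix (Fin 2) (Fin 2) ℂ) * star (U : Matrix (Fin 2) (Fin 2) ℂ) = 1 :=
  Matrix.mem_unitaryGroup_iff.1 U.2

theorem networkChannel_append {m : ℕ} (U : ℕ → Matrix.unitaryGroup (Fin 2) ℂ) (η : ℝ)
    (A B : Network m) (ρ : FockOp m) :
    networkChannel U η (A ++ B) ρ = networkChannel U η B (networkChannel U η A ρ) :=
  List.foldl_append

theorem IsTraceClass.networkChannel {m : ℕ} (U : ℕ → Matrix.unitaryGroup (Fin 2) ℂ) {η : ℝ}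
    (h0 : 0 ≤ η) (h1 : η ≤ 1) (N : Network m) {ρ : FockOp m} (h : IsTraceClass ρ) :
    IsTraceClass (networkChannel U η N ρ) := by
  induction N generalizing ρ with
  | nil => exact h
  | cons c N ih =>
    refine ih ?_
    cases c with
    | loss i => exact h.lossChannel h0 h1 i
    | split b => exact h.gateChannel (unitary_mul_star _) b.ne

theorem networkChannel_move {m : ℕ} (U : ℕ → Matrix.unitaryGroup (Fin 2) ℂ) {η : ℝ}
    (h0 : 0 ≤ η) (h1 : η ≤ 1) {N N' : Network m} (hN : Move N N') {ρ : FockOp m}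
    (h : IsTraceClass ρ) : networkChannel U η N ρ = networkChannel U η N' ρ := by
  -- The components before the altered piece preserve the trace class, so equality on that class
  -- suffices inside any network.
  have key : ∀ A B C C' : Network m,
      (∀ σ : FockOp m, IsTraceClass σ → networkChannel U η C σ = networkChannel U η C' σ) →
      networkChannel U η (A ++ C ++ B) ρ = networkChannel U η (A ++ C' ++ B) ρ := by
    intro A B C C' hC
    simp only [networkChannel_append]
    rw [hC _ (h.networkChannel U h0 h1 A)]
  have hsingle : ∀ (b : Beamsplitter m) (i : Fin m), i ≠ b.fst → i ≠ b.snd → ∀ σ : FockOp m,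
      IsTraceClass σ → networkChannel U η [Component.split b, Component.loss i] σ =
        networkChannel U η [Component.loss i, Component.split b] σ := by
    intro b i hf hs σ hσ
    exact gateChannel_comm_of_hasSum_jumpTerm (unitary_mul_star _) b.ne (S := {i})
      (by simp [hf.symm, hs.symm]) η (lossChannel η i)
      (fun ρ hρ p q => hρ.hasSum_jumpTerm_single h0 h1 i p q) hσ
  cases hN with
  | comm A B i j =>
    refine key A B _ _ fun σ hσ => ?_
    by_cases hij : i = j
    · rw [hij]
    · exact lossChannel_comm ⟨h0, h1⟩ ⟨h0, h1⟩ (Ne.symm hij) hσ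
  | left A B b i hf hs => exact key A B _ _ (hsingle b i hf hs)
  | right A B b i hf hs => exact key A B _ _ fun σ hσ => (hsingle b i hf hs σ hσ).symm
  | pull A B b =>
    refine key A B _ _ fun σ hσ => ?_
    exact gateChannel_comm_of_hasSum_jumpTerm (unitary_mul_star _) b.ne (S := {b.snd, b.fst})
      (by simp) η (fun ρ => lossChannel η b.snd (lossChannel η b.fst ρ))
      (fun ρ hρ p q => hρ.hasSum_jumpTerm_pair h0 h1 b.ne.symm p q) hσ

/-! ### Uniform losses -/

theorem lossChannel_foldl_comm {m : ℕ} {η₁ η₂ : ℝ} (h₁ : 0 ≤ η₁ ∧ η₁ ≤ 1)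
    (h₂ : 0 ≤ η₂ ∧ η₂ ≤ 1) {i : Fin m} (l : List (Fin m)) (hi : i ∉ l) {ρ : FockOp m}
    (h : IsTraceClass ρ) :
    lossChannel η₁ i (l.foldl (fun σ j => lossChannel η₂ j σ) ρ) =
      l.foldl (fun σ j => lossChannel η₂ j σ) (lossChannel η₁ i ρ) := by
  induction l generalizing ρ with
  | nil => rfl
  | cons j l ih =>
    rw [List.mem_cons, not_or] at hi
    rw [List.foldl_cons, List.foldl_cons, ih hi.2 (h.lossChannel h₂.1 h₂.2 j),
      lossChannel_comm h₁ h₂ hi.1 h]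

theorem foldl_lossChannel_foldl {m : ℕ} {η₁ η₂ : ℝ} (h₁ : 0 ≤ η₁ ∧ η₁ ≤ 1)
    (h₂ : 0 ≤ η₂ ∧ η₂ ≤ 1) (l : List (Fin m)) (hl : l.Nodup) {ρ : FockOp m}
    (h : IsTraceClass ρ) :
    l.foldl (fun σ j => lossChannel η₁ j σ) (l.foldl (fun σ j => lossChannel η₂ j σ) ρ) =
      l.foldl (fun σ j => lossChannel (η₁ * η₂) j σ) ρ := by
  induction l generalizing ρ with
  | nil => rfl
  | cons i l ih =>
    rw [List.nodup_cons] at hl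
    rw [List.foldl_cons, List.foldl_cons, List.foldl_cons,
      lossChannel_foldl_comm h₁ h₂ l hl.1 (h.lossChannel h₂.1 h₂.2 i),
      lossChannel_lossChannel h₁ h₂ i h]
    exact ih hl.2 (h.lossChannel (mul_nonneg h₁.1 h₂.1) (mul_le_one₀ h₁.2 h₂.1 h₂.2) i)

theorem networkChannel_uniformLayer {m : ℕ} (U : ℕ → Matrix.unitaryGroup (Fin 2) ℂ) (η : ℝ)
    (ρ : FockOp m) : networkChannel U η (uniformLayer m) ρ = uniformLoss η ρ := by
  rw [networkChannel, uniformLayer, List.foldl_map]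
  rfl

theorem networkChannel_layers {m : ℕ} (U : ℕ → Matrix.unitaryGroup (Fin 2) ℂ) {η : ℝ}
    (h0 : 0 ≤ η) (h1 : η ≤ 1) (s : ℕ) {ρ : FockOp m} (h : IsTraceClass ρ) :
    networkChannel U η (List.replicate s (uniformLayer m)).flatten ρ = uniformLoss (η ^ s) ρ := by
  induction s with
  | zero =>
    have : ∀ l : List (Fin m), l.foldl (fun σ j => lossChannel (η ^ 0) j σ) ρ = ρ := by
      intro l
      induction l with
      | nil => rfl
      | cons i l ih => rw [List.foldl_cons, pow_zero, lossChannel_one]; rwa [pow_zero] at ih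
    exact (this _).symm
  | succ s ih =>
    rw [List.replicate_succ', List.flatten_append, networkChannel_append, ih, List.flatten_cons,
      List.flatten_nil, List.append_nil, networkChannel_uniformLayer, pow_succ']
    exact foldl_lossChannel_foldl ⟨h0, h1⟩ ⟨pow_nonneg h0 s, pow_le_one₀ h0 h1⟩ _
      (List.nodup_finRange m) h

theorem networkChannel_of_pullsOut {m : ℕ} (U : ℕ → Matrix.unitaryGroup (Fin 2) ℂ) {η : ℝ}
    (h0 : 0 ≤ η) (h1 : η ≤ 1) {N N' : Network m} {s : ℕ} (hN : PullsOut N s N')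
    {ρ : FockOp m} (h : IsTraceClass ρ) :
    networkChannel U η N ρ = networkChannel U η N' (uniformLoss (η ^ s) ρ) := by
  rw [← networkChannel_layers U h0 h1 s h, ← networkChannel_append]
  unfold PullsOut at hN
  generalize (List.replicate s (uniformLayer m)).flatten ++ N' = M at hN ⊢
  induction hN with
  | refl => rfl
  | tail _ hM ih => rw [ih, networkChannel_move U h0 h1 hM h]

/-! ### Shortest paths -/

/-- `outDist bs a` is the smallest number of beamsplitters on a path that enters in mode `a`. -/
def outDist {m : ℕ} : List (Beamsplitter m) → ℕ → ℕ
  | [], _ => 0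
  | b :: bs, a =>
    if a = b.fst ∨ a = b.snd then min (outDist bs b.fst) (outDist bs b.snd) + 1 else outDist bs a

theorem outDist_le_length {m : ℕ} (bs : List (Beamsplitter m)) (a : ℕ) :
    outDist bs a ≤ bs.length := by
  induction bs generalizing a with
  | nil => exact le_rfl
  | cons b bs ih =>
    have h1 := ih b.fst
    have h2 := ih a
    simp only [outDist, List.length_cons]
    split_ifs <;> omega

/-- Leaving every beamsplitter by the arm with the smaller remaining distance realises the
recursion. -/
theorem exists_pathCrosses_outDist {m : ℕ} (bs : List (Beamsplitter m)) (a : Fin m) :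
    ∃ b, PathCrosses (lossyNetwork bs) a b (outDist bs a) := by
  induction bs generalizing a with
  | nil => exact ⟨a, PathCrosses.nil a⟩
  | cons e bs ih =>
    by_cases ha : a = e.fst ∨ a = e.snd
    · have hd : outDist (e :: bs) a = min (outDist bs e.fst) (outDist bs e.snd) + 1 := by
        rw [outDist, if_pos]
        exact ha.imp (congrArg _) (congrArg _)
      rw [hd]
      rcases le_total (outDist bs e.fst) (outDist bs e.snd) with h | h
      · obtain ⟨b, hb⟩ := ih e.fst
        rw [min_eq_left h]
        exact ⟨b, .loss _ (.loss _ (.cross e ha (Or.inl rfl) hb))⟩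
      · obtain ⟨b, hb⟩ := ih e.snd
        rw [min_eq_right h]
        exact ⟨b, .loss _ (.loss _ (.cross e ha (Or.inr rfl) hb))⟩
    · obtain ⟨b, hb⟩ := ih a
      have hd : outDist (e :: bs) a = outDist bs a := by
        rw [outDist, if_neg]
        simpa only [Fin.val_inj] using ha
      rw [hd]
      rw [not_or] at ha
      exact ⟨b, .loss _ (.loss _ (.pass e ha.1 ha.2 hb))⟩

theorem outDist_le_of_pathCrosses {m : ℕ} (bs : List (Beamsplitter m)) {a b : Fin m} {k : ℕ}
    (h : PathCrosses (lossyNetwork bs) a b k) : outDist bs a ≤ k := by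
  induction bs generalizing a k with
  | nil => exact Nat.zero_le k
  | cons e bs ih =>
    change PathCrosses (.loss e.fst :: .loss e.snd :: .split e :: lossyNetwork bs) a b k at h
    cases h with
    | loss _ h =>
      cases h with
      | loss _ h =>
        cases h with
        | pass _ hf hs h =>
          rw [outDist, if_neg]
          · exact ih h
          · simpa only [Fin.val_inj, not_or] using ⟨hf, hs⟩
        | cross _ ha ha' h =>
          rw [outDist, if_pos (ha.imp (congrArg _) (congrArg _))]
          have := ih h
          rcases ha' with rfl | rfl <;> omega

/-! ### Moving losses through a network -/

/-- A sequence of loss elements in the given modes. -/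
abbrev losses {m : ℕ} (l : List (Fin m)) : Network m := l.map Component.loss

/-- `c a` loss elements in each mode `a`. -/
def lossLayers {m : ℕ} (c : ℕ → ℕ) : List (Fin m) :=
  (List.finRange m).flatMap fun a : Fin m => List.replicate (c a) a

theorem count_lossLayers {m : ℕ} (c : ℕ → ℕ) (a : Fin m) : (lossLayers c).count a = c a := by
  have : ∀ l : List (Fin m), l.Nodup →
      (l.flatMap fun a : Fin m => List.replicate (c a) a).count a = if a ∈ l then c a else 0 := by
    intro l hl
    induction l with
    | nil => simp
    | cons b l ih =>
      rw [List.nodup_cons] at hl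
      rw [List.flatMap_cons, List.count_append, ih hl.2, List.count_replicate]
      by_cases hab : b = a
      · subst hab
        simp [hl.1]
      · simp [hab, Ne.symm hab]
  rw [lossLayers, this _ (List.nodup_finRange m), if_pos (List.mem_finRange a)]

/-- What remains of the network built from the beamsplitters `bs` when all loss elements that can be
moved to the input are removed. -/
def lossyCore {m : ℕ} : List (Beamsplitter m) → Network m
  | [] => []
  | b :: bs => Component.split b ::
      (losses (List.replicate (outDist bs b.fst - outDist bs b.snd) b.fst) ++
        (losses (List.replicate (outDist bs b.snd - outDist bs b.fst) b.snd) ++ lossyCore bs))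

/-- What remains when `s` uniform layers of losses are removed. -/
def reducedNetwork {m : ℕ} (bs : List (Beamsplitter m)) (s : ℕ) : Network m :=
  losses (lossLayers fun a => outDist bs a - s) ++ lossyCore bs

/-- Loss elements can be moved such that the first network becomes the second. -/
abbrev Moves {m : ℕ} : Network m → Network m → Prop := Relation.ReflTransGen Move

theorem Move.context {m : ℕ} (X Y : Network m) {N N' : Network m} (h : Move N N') :
    Move (X ++ N ++ Y) (X ++ N' ++ Y) := by
  cases h with
  | comm A B i j => simpa using Move.comm (X ++ A) (B ++ Y) i j
  | left A B b i hf hs => simpa using Move.left (X ++ A) (B ++ Y) b i hf hs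
  | right A B b i hf hs => simpa using Move.right (X ++ A) (B ++ Y) b i hf hs
  | pull A B b => simpa using Move.pull (X ++ A) (B ++ Y) b

theorem Moves.context {m : ℕ} (X Y : Network m) {N N' : Network m} (h : Moves N N') :
    Moves (X ++ N ++ Y) (X ++ N' ++ Y) :=
  h.lift (fun N => X ++ N ++ Y) fun _ _ h => h.context X Y

theorem Moves.append_left {m : ℕ} (X : Network m) {N N' : Network m} (h : Moves N N') :
    Moves (X ++ N) (X ++ N') := by
  simpa using h.context X []

theorem Moves.append_right {m : ℕ} (Y : Network m) {N N' : Network m} (h : Moves N N') :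
    Moves (N ++ Y) (N' ++ Y) := by
  simpa using h.context [] Y

theorem Moves.of_perm {m : ℕ} {l l' : List (Fin m)} (h : l.Perm l') :
    Moves (losses l) (losses l') := by
  induction h with
  | nil => exact .refl
  | cons a _ ih => exact ih.append_left [Component.loss a]
  | swap a b l => exact .single (Move.comm [] (losses l) b a)
  | trans _ _ ih₁ ih₂ => exact ih₁.trans ih₂

theorem Moves.of_count {m : ℕ} {l l' : List (Fin m)} (h : ∀ a, l.count a = l'.count a) :
    Moves (losses l) (losses l') :=
  .of_perm (List.perm_iff_count.2 h)

theorem Moves.past_split {m : ℕ} (b : Beamsplitter m) (l : List (Fin m))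
    (hl : ∀ i ∈ l, i ≠ b.fst ∧ i ≠ b.snd) :
    Moves (Component.split b :: losses l) (losses l ++ [Component.split b]) := by
  induction l with
  | nil => exact .refl
  | cons i l ih =>
    have h1 : Moves (Component.split b :: losses (i :: l))
        (Component.loss i :: Component.split b :: losses l) :=
      .single (Move.left [] (losses l) b i (hl i (by simp)).1 (hl i (by simp)).2)
    exact h1.trans ((ih fun j hj => hl j (List.mem_cons_of_mem i hj)).append_left [Component.loss i])

theorem Moves.pull_pairs {m : ℕ} (b : Beamsplitter m) (k : ℕ) :
    Moves (Component.split b :: losses (List.replicate k [b.fst, b.snd]).flatten)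
      (losses (List.replicate k [b.fst, b.snd]).flatten ++ [Component.split b]) := by
  induction k with
  | zero => exact .refl
  | succ k ih =>
    have h1 : Moves
        (Component.split b :: losses (List.replicate (k + 1) [b.fst, b.snd]).flatten)
        ([Component.loss b.fst, Component.loss b.snd] ++
          (Component.split b :: losses (List.replicate k [b.fst, b.snd]).flatten)) :=
      .single (Move.pull [] (losses (List.replicate k [b.fst, b.snd]).flatten) b)
    exact h1.trans (ih.append_left [Component.loss b.fst, Component.loss b.snd])

theorem count_flatten_replicate {m : ℕ} (k : ℕ) (l : List (Fin m)) (a : Fin m) :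
    ((List.replicate k l).flatten).count a = k * l.count a := by
  induction k with
  | zero => simp
  | succ k ih => rw [List.replicate_succ, List.flatten_cons, List.count_append, ih]; ring

/-- By induction the losses of the later network stand right behind the first block. Losses in other
modes pass its beamsplitter, pairs are pulled through, and the unpaired ones stay behind as part of
`lossyCore`. -/
theorem Moves.lossyNetwork {m : ℕ} (bs : List (Beamsplitter m)) :
    Moves (lossyNetwork bs) (losses (lossLayers (outDist bs)) ++ lossyCore bs) := by
  induction bs with
  | nil =>
    have : (lossLayers (outDist ([] : List (Beamsplitter m))) : List (Fin m)) = [] := by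
      simp [lossLayers, outDist]
    rw [this]
    exact .refl
  | cons b bs ih =>
    set f : ℕ := outDist bs b.fst with hf
    set s : ℕ := outDist bs b.snd with hs
    let k := min f s
    let rest : List (Fin m) :=
      lossLayers fun a => if a = b.fst ∨ a = b.snd then 0 else outDist bs a
    let pairs : List (Fin m) := (List.replicate k [b.fst, b.snd]).flatten
    -- Subtraction is truncated, so at most one of the two lists is nonempty.
    let extra : List (Fin m) := List.replicate (f - s) b.fst ++ List.replicate (s - f) b.snd
    have hne := b.ne
    have hcount : ∀ a, (lossLayers (outDist bs)).count a = (rest ++ (pairs ++ extra)).count a := by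
      intro a
      simp only [rest, pairs, extra, List.count_append, count_lossLayers, count_flatten_replicate,
        List.count_replicate, List.count_cons, List.count_nil, Fin.val_inj, beq_iff_eq]
      by_cases h1 : a = b.fst
      · subst h1
        simp only [true_or, if_true, if_neg hne.symm, ← hf, k]
        omega
      · by_cases h2 : a = b.snd
        · subst h2
          simp only [or_true, if_true, if_neg hne, ← hs, k]
          omega
        · simp [h1, h2, Ne.symm h1, Ne.symm h2]
    -- The losses of the block itself supply the `+ 1` in the recursion for `outDist`.
    have hcount' : ∀ a, (b.fst :: b.snd :: (rest ++ pairs)).count a =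
        (lossLayers (outDist (b :: bs))).count a := by
      intro a
      simp only [rest, pairs, List.count_append, count_lossLayers, count_flatten_replicate,
        List.count_cons, List.count_nil, Fin.val_inj, beq_iff_eq, outDist]
      by_cases h1 : a = b.fst
      · subst h1
        simp only [true_or, if_true, if_neg hne.symm, ← hf, ← hs, k]
        omega
      · by_cases h2 : a = b.snd
        · subst h2
          simp only [or_true, if_true, if_neg hne, ← hf, ← hs, k]
          omega
        · simp [h1, h2, Ne.symm h1, Ne.symm h2]
    have hrest : ∀ i ∈ rest, i ≠ b.fst ∧ i ≠ b.snd := by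
      intro i hi
      have := List.count_pos_iff.2 hi
      simp only [rest, count_lossLayers, Fin.val_inj] at this
      by_contra hc
      rw [if_pos (by tauto)] at this
      exact lt_irrefl _ this
    have h1 : Moves (LossyOptics.lossyNetwork (b :: bs))
        (block b ++ (losses (rest ++ (pairs ++ extra)) ++ lossyCore bs)) :=
      Moves.append_left (block b) (ih.trans ((Moves.of_count hcount).append_right _))
    have h2 := (Moves.past_split b rest hrest).context (losses [b.fst, b.snd])
      (losses pairs ++ losses extra ++ lossyCore bs)
    have h3 := (Moves.pull_pairs b k).context (losses ([b.fst, b.snd] ++ rest))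
      (losses extra ++ lossyCore bs)
    have h4 := (Moves.of_count hcount').append_right
      (Component.split b :: (losses extra ++ lossyCore bs))
    have h23 := h2.trans (by simpa [pairs] using h3)
    have h5 := h1.trans (by simpa [block] using h23)
    have h6 := h5.trans (by simpa [pairs] using h4)
    simpa [lossyCore, extra] using h6

theorem flatten_replicate_uniformLayer (m s : ℕ) :
    (List.replicate s (uniformLayer m)).flatten =
      losses (List.replicate s (List.finRange m)).flatten := by
  simp [uniformLayer, losses, List.map_flatten]

theorem pullsOut_reducedNetwork {m : ℕ} (bs : List (Beamsplitter m)) (s : ℕ)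
    (hs : ∀ a : Fin m, s ≤ outDist bs a) :
    PullsOut (lossyNetwork bs) s (reducedNetwork bs s) := by
  refine (Moves.lossyNetwork bs).trans ?_
  rw [reducedNetwork, flatten_replicate_uniformLayer, ← List.append_assoc, ← List.map_append]
  refine Moves.append_right _ (Moves.of_count fun a => ?_)
  rw [List.count_append, count_flatten_replicate, count_lossLayers, count_lossLayers,
    List.count_eq_one_of_mem (List.nodup_finRange m) (List.mem_finRange a)]
  have := hs a
  omega

/-! ### Invariants of moves -/

theorem beamsplitters_append {m : ℕ} (A B : Network m) :
    beamsplitters (A ++ B) = beamsplitters A ++ beamsplitters B :=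
  List.filterMap_append

theorem beamsplitters_losses {m : ℕ} (l : List (Fin m)) : beamsplitters (losses l) = [] := by
  simp [beamsplitters, losses, List.filterMap_map]

theorem beamsplitters_reducedNetwork {m : ℕ} (bs : List (Beamsplitter m)) (s : ℕ) :
    beamsplitters (reducedNetwork bs s) = bs := by
  rw [reducedNetwork, beamsplitters_append, beamsplitters_losses, List.nil_append]
  induction bs with
  | nil => rfl
  | cons b bs ih =>
    change beamsplitters ([Component.split b] ++ (_ ++ (_ ++ _))) = _
    rw [beamsplitters_append, beamsplitters_append, beamsplitters_append, beamsplitters_losses,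
      beamsplitters_losses, ih]
    rfl

theorem lossCount_append {m : ℕ} (A B : Network m) :
    lossCount (A ++ B) = lossCount A + lossCount B :=
  List.countP_append

theorem lossCount_of_moves {m : ℕ} {N N' : Network m} (h : Moves N N') :
    lossCount N = lossCount N' := by
  induction h with
  | refl => rfl
  | tail _ h ih =>
    rw [ih]
    cases h <;> simp [lossCount, List.countP_append]

theorem lossCount_of_pullsOut {m : ℕ} {N N' : Network m} {s : ℕ} (h : PullsOut N s N') :
    lossCount N' + s * m = lossCount N := by
  have hl : ∀ l : List (Fin m), lossCount (losses l) = l.length := by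
    intro l
    simp [lossCount, losses, List.countP_map, Function.comp_def]
  rw [lossCount_of_moves h, lossCount_append, flatten_replicate_uniformLayer, hl, add_comm]
  simp

/-! ### Memory layout and execution -/

/-- A memory with the output written so far in array `1` and its length in register `1`. -/
structure Memory where
  pos : ℕ
  out : List ℕ
  layers : ℕ
  mode : ℕ
  count : ℕ
  size : ℕ
  input : ℕ → ℕ
  dist : ℕ → ℕ
  fstExtra : ℕ → ℕ
  sndExtra : ℕ → ℕ

/-- The registers and arrays in which the components of a memory are stored. -/
def Memory.toStore (μ : Memory) : Store where
  reg := fun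
    | 0 => μ.pos
    | 1 => μ.out.length
    | 2 => μ.layers
    | 3 => μ.mode
    | 4 => μ.count
    | 5 => μ.size
    | _ => 0
  arr := fun
    | 0 => μ.input
    | 1 => fun k => μ.out.getD k 0
    | 2 => μ.dist
    | 3 => μ.fstExtra
    | 4 => μ.sndExtra
    | _ => fun _ => 0

/-- Started with memory `μ`, the program `P` halts with memory `μ'` after at most `t` steps. -/
def Exec (P : Program) (μ μ' : Memory) (t : ℕ) : Prop :=
  ∃ t' ≤ t, Runs P μ.toStore μ'.toStore t'

theorem Exec.mono {P : Program} {μ μ' : Memory} {t u : ℕ} (h : Exec P μ μ' t) (htu : t ≤ u) :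
    Exec P μ μ' u :=
  let ⟨t', ht', hr⟩ := h
  ⟨t', ht'.trans htu, hr⟩

theorem Exec.seq {P Q : Program} {μ μ' μ'' : Memory} {t u : ℕ} (h : Exec P μ μ' t)
    (h' : Exec Q μ' μ'' u) : Exec (.seq P Q) μ μ'' (t + u) :=
  let ⟨t', ht', hr⟩ := h
  let ⟨u', hu', hr'⟩ := h'
  ⟨t' + u', Nat.add_le_add ht' hu', .seq hr hr'⟩

/-- A loop rule with an invariant indexed by the iteration: `n` passes, each costing one test and at
most `t` steps, then one failing test. -/
theorem exec_loop (I : ℕ → Memory → Prop) (e₁ e₂ : Expr) (P : Program) (n t : ℕ)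
    (hstep : ∀ k μ, k < n → I k μ → e₁.eval μ.toStore < e₂.eval μ.toStore ∧
      ∃ μ', Exec P μ μ' t ∧ I (k + 1) μ')
    (hexit : ∀ μ, I n μ → ¬ e₁.eval μ.toStore < e₂.eval μ.toStore) {μ : Memory} (h0 : I 0 μ) :
    ∃ μ', Exec (.loop e₁ e₂ P) μ μ'
      (n * (e₁.cost + e₂.cost + 1 + t) + (e₁.cost + e₂.cost + 1)) ∧ I n μ' := by
  suffices h : ∀ d k μ, k + d = n → I k μ → ∃ μ', Exec (.loop e₁ e₂ P) μ μ'
      (d * (e₁.cost + e₂.cost + 1 + t) + (e₁.cost + e₂.cost + 1)) ∧ I n μ' from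
    h n 0 μ (Nat.zero_add n) h0
  intro d
  induction d with
  | zero =>
    intro k μ hk hI
    obtain rfl : k = n := hk
    exact ⟨μ, ⟨_, by omega, .loop_false (hexit μ hI)⟩, hI⟩
  | succ d ih =>
    intro k μ hk hI
    obtain ⟨hlt, μ', ⟨t', ht', hr⟩, hI'⟩ := hstep k μ (by omega) hI
    obtain ⟨μ'', ⟨u, hu, hr'⟩, hI''⟩ := ih (k + 1) μ' (by omega) hI'
    refine ⟨μ'', ⟨_, ?_, .loop_true hlt hr hr'⟩, hI''⟩
    rw [Nat.succ_mul]
    omega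

theorem exec_set {r : ℕ} {e : Expr} {μ μ' : Memory}
    (hr : μ'.toStore.reg = Function.update μ.toStore.reg r (e.eval μ.toStore))
    (ha : μ'.toStore.arr = μ.toStore.arr) : Exec (.set r e) μ μ' (e.cost + 1) := by
  have : μ'.toStore = ⟨_, _⟩ := congrArg₂ Store.mk hr ha
  refine ⟨_, le_rfl, ?_⟩
  rw [this]
  exact .set r e _

theorem exec_put {A : ℕ} {e₁ e₂ : Expr} {μ μ' : Memory}
    (hr : μ'.toStore.reg = μ.toStore.reg)
    (ha : μ'.toStore.arr = Function.update μ.toStore.arr A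
      (Function.update (μ.toStore.arr A) (e₁.eval μ.toStore) (e₂.eval μ.toStore))) :
    Exec (.put A e₁ e₂) μ μ' (e₁.cost + e₂.cost + 1) := by
  have : μ'.toStore = ⟨_, _⟩ := congrArg₂ Store.mk hr ha
  refine ⟨_, le_rfl, ?_⟩
  rw [this]
  exact .put A e₁ e₂ _

theorem exec_set_pos (e : Expr) (μ : Memory) :
    Exec (.set 0 e) μ { μ with pos := e.eval μ.toStore } (e.cost + 1) :=
  exec_set (funext fun r => by rcases r with _ | _ | _ | _ | _ | _ | r <;> rfl) rfl

theorem exec_set_layers (e : Expr) (μ : Memory) :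
    Exec (.set 2 e) μ { μ with layers := e.eval μ.toStore } (e.cost + 1) :=
  exec_set (funext fun r => by rcases r with _ | _ | _ | _ | _ | _ | r <;> rfl) rfl

theorem exec_set_mode (e : Expr) (μ : Memory) :
    Exec (.set 3 e) μ { μ with mode := e.eval μ.toStore } (e.cost + 1) :=
  exec_set (funext fun r => by rcases r with _ | _ | _ | _ | _ | _ | r <;> rfl) rfl

theorem exec_set_count (e : Expr) (μ : Memory) :
    Exec (.set 4 e) μ { μ with count := e.eval μ.toStore } (e.cost + 1) :=
  exec_set (funext fun r => by rcases r with _ | _ | _ | _ | _ | _ | r <;> rfl) rfl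

theorem exec_set_size (e : Expr) (μ : Memory) :
    Exec (.set 5 e) μ { μ with size := e.eval μ.toStore } (e.cost + 1) :=
  exec_set (funext fun r => by rcases r with _ | _ | _ | _ | _ | _ | r <;> rfl) rfl

theorem exec_put_dist (e₁ e₂ : Expr) (μ : Memory) :
    Exec (.put 2 e₁ e₂) μ
      { μ with dist := (Function.update μ.dist (e₁.eval μ.toStore) (e₂.eval μ.toStore)) } (e₁.cost + e₂.cost + 1) :=
  exec_put rfl (funext fun r => by rcases r with _ | _ | _ | _ | _ | r <;> rfl)

theorem exec_put_fstExtra (e₁ e₂ : Expr) (μ : Memory) :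
    Exec (.put 3 e₁ e₂) μ
      { μ with fstExtra := (Function.update μ.fstExtra (e₁.eval μ.toStore) (e₂.eval μ.toStore)) }
      (e₁.cost + e₂.cost + 1) :=
  exec_put rfl (funext fun r => by rcases r with _ | _ | _ | _ | _ | r <;> rfl)

theorem exec_put_sndExtra (e₁ e₂ : Expr) (μ : Memory) :
    Exec (.put 4 e₁ e₂) μ
      { μ with sndExtra := (Function.update μ.sndExtra (e₁.eval μ.toStore) (e₂.eval μ.toStore)) }
      (e₁.cost + e₂.cost + 1) :=
  exec_put rfl (funext fun r => by rcases r with _ | _ | _ | _ | _ | r <;> rfl)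

/-! ### Writing the output -/

/-- Append the value of an expression to the output. -/
def emit (e : Expr) : Program :=
  .seq (.put 1 (.var 1) e) (.set 1 (.add (.var 1) (.const 1)))

theorem exec_emit (e : Expr) (μ : Memory) :
    Exec (emit e) μ { μ with out := μ.out ++ [e.eval μ.toStore] } (e.cost + 6) := by
  have hr : ({ μ with out := μ.out ++ [e.eval μ.toStore] } : Memory).toStore.reg =
      Function.update μ.toStore.reg 1 (μ.out.length + 1) := by
    funext r
    rcases r with _ | _ | _ | _ | _ | _ | r <;> simp [Memory.toStore, Function.update]
  have ha : ({ μ with out := μ.out ++ [e.eval μ.toStore] } : Memory).toStore.arr =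
      Function.update μ.toStore.arr 1 (Function.update (μ.toStore.arr 1)
        μ.out.length (e.eval μ.toStore)) := by
    funext r
    rcases r with _ | _ | _ | _ | _ | r <;> try rfl
    funext k
    simp only [Memory.toStore, Function.update_apply]
    -- Cells past the end of the output read as `0` on both sides, so writing at the cell numbered
    -- by the length is the same as appending.
    rcases lt_trichotomy k μ.out.length with h | h | h
    · simp [List.getElem?_append_left h, h.ne]
    · simp [h]
    · have h1 : μ.out.length + 1 ≤ k := h
      simp [h.ne', List.getElem?_eq_none, h1, h.le]
  have h : ({ μ with out := μ.out ++ [e.eval μ.toStore] } : Memory).toStore = ⟨_, _⟩ :=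
    congrArg₂ Store.mk hr ha
  refine ⟨1 + e.cost + 1 + 4, by omega, ?_⟩
  rw [h]
  exact .seq (.put 1 (.var 1) e _) (.set 1 (.add (.var 1) (.const 1)) _)

/-- Append the descriptions of as many loss elements as register `4` says, in the mode given by an
expression. -/
def emitLosses (e : Expr) : Program :=
  .loop (.const 0) (.var 4)
    (.seq (emit (.const 0)) (.seq (emit e) (.set 4 (.sub (.var 4) (.const 1)))))

/-- The loop alters only the output and the counter, so `he` guarantees that the mode expression
keeps its value throughout. -/
theorem exec_emitLosses (e : Expr) (μ : Memory) (a : ℕ)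
    (he : ∀ l c, e.eval { μ with out := l, count := c }.toStore = a) :
    Exec (emitLosses e) μ
      { μ with out := μ.out ++ (List.replicate μ.count [0, a]).flatten, count := 0 }
      (μ.count * (e.cost + 20) + 3) := by
  obtain ⟨μ', hμ', rfl⟩ := exec_loop (fun k ν => ν =
      { μ with out := μ.out ++ (List.replicate k [0, a]).flatten, count := μ.count - k })
    (.const 0) (.var 4)
    (.seq (emit (.const 0)) (.seq (emit e) (.set 4 (.sub (.var 4) (.const 1)))))
    μ.count (e.cost + 17) (by
      rintro k _ hk rfl
      refine ⟨by simpa [Expr.eval, Memory.toStore] using hk, _,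
        ((exec_emit _ _).seq ((exec_emit _ _).seq (exec_set_count _ _))).mono ?_, ?_⟩
      · simp only [Expr.cost]
        omega
      · rw [he, List.replicate_succ', List.flatten_append]
        simp [Expr.eval, Memory.toStore]
        omega)
    (by
      rintro _ rfl
      simp [Expr.eval, Memory.toStore]) (μ := μ) (by simp)
  rw [Nat.sub_self] at hμ'
  refine hμ'.mono ?_
  simp only [Expr.cost]
  ring_nf
  omega

/-! ### Descriptions -/

theorem words_losses_replicate {m : ℕ} (c : ℕ) (i : Fin m) :
    (losses (List.replicate c i)).flatMap Component.words =
      (List.replicate c [0, (i : ℕ)]).flatten := by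
  simp [losses, List.flatMap, Component.words]

theorem words_lossLayers {m : ℕ} (c : ℕ → ℕ) :
    (losses (lossLayers c : List (Fin m))).flatMap Component.words =
      (List.range m).flatMap fun a => (List.replicate (c a) [0, a]).flatten := by
  have h : ∀ l : List (Fin m),
      (losses (l.flatMap fun a : Fin m => List.replicate (c a) a)).flatMap Component.words =
        (l.map Fin.val).flatMap fun a => (List.replicate (c a) [0, a]).flatten := by
    intro l
    induction l with
    | nil => rfl
    | cons i l ih =>
      rw [List.flatMap_cons, losses, List.map_append, List.flatMap_append, ih,
        words_losses_replicate, List.map_cons, List.flatMap_cons]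
  rw [lossLayers, h, List.map_coe_finRange_eq_range]

theorem describe_reducedNetwork {m : ℕ} (bs : List (Beamsplitter m)) (s : ℕ) :
    describe (reducedNetwork bs s) =
      m :: ((List.range m).flatMap fun a => (List.replicate (outDist bs a - s) [0, a]).flatten) ++
        (lossyCore bs).flatMap Component.words := by
  rw [describe, reducedNetwork, List.flatMap_append, words_lossLayers]
  rfl

theorem words_lossyCore_cons {m : ℕ} (b : Beamsplitter m) (bs : List (Beamsplitter m)) :
    (lossyCore (b :: bs)).flatMap Component.words =
      [1, (b.fst : ℕ), (b.snd : ℕ), b.gate] ++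
        ((List.replicate (outDist bs b.fst - outDist bs b.snd) [0, (b.fst : ℕ)]).flatten ++
          ((List.replicate (outDist bs b.snd - outDist bs b.fst) [0, (b.snd : ℕ)]).flatten ++
            (lossyCore bs).flatMap Component.words)) := by
  rw [lossyCore, List.flatMap_cons, List.flatMap_append, List.flatMap_append,
    words_losses_replicate, words_losses_replicate]
  rfl

theorem describe_lossyNetwork_length {m : ℕ} (bs : List (Beamsplitter m)) :
    (describe (lossyNetwork bs)).length = 1 + 8 * bs.length := by
  induction bs with
  | nil => rfl
  | cons b bs ih =>
    have h : describe (lossyNetwork (b :: bs)) = m :: ([0, (b.fst : ℕ), 0, (b.snd : ℕ), 1,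
      (b.fst : ℕ), (b.snd : ℕ), b.gate] ++ (lossyNetwork bs).flatMap Component.words) := rfl
    rw [describe, List.length_cons] at ih
    rw [h, List.length_cons, List.length_append, List.length_cons]
    simp only [List.length_cons, List.length_nil]
    omega

/-- A block takes eight words, two for each loss and four for the beamsplitter, after one initial
word for the number of modes. The words at offsets 5, 6 and 7 are the ones the program reads. -/
theorem describe_lossyNetwork_getD {m : ℕ} (bs : List (Beamsplitter m)) (i : ℕ)
    (hi : i < bs.length) (j : ℕ) (hj : j < 8) :
    (describe (lossyNetwork bs)).getD (1 + 8 * i + j) 0 =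
      [0, (bs[i].fst : ℕ), 0, (bs[i].snd : ℕ), 1, (bs[i].fst : ℕ), (bs[i].snd : ℕ),
        bs[i].gate].getD j 0 := by
  induction bs generalizing i with
  | nil => exact absurd hi (Nat.not_lt_zero i)
  | cons b bs ih =>
    have h : describe (lossyNetwork (b :: bs)) = m :: ([0, (b.fst : ℕ), 0, (b.snd : ℕ), 1,
      (b.fst : ℕ), (b.snd : ℕ), b.gate] ++ (lossyNetwork bs).flatMap Component.words) := rfl
    cases i with
    | zero =>
      rw [h, show 1 + 8 * 0 + j = j + 1 by omega, List.getD_cons_succ,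
        List.getD_append _ _ _ _ (by simpa using hj)]
      rfl
    | succ i =>
      have hi' : i < bs.length := Nat.lt_of_succ_lt_succ hi
      have := ih i hi'
      rw [describe, show 1 + 8 * i + j = 8 * i + j + 1 by omega, List.getD_cons_succ] at this
      rw [h, show 1 + 8 * (i + 1) + j = 8 * i + j + 8 + 1 by omega, List.getD_cons_succ,
        List.getD_append_right _ _ _ _ (by simp)]
      exact this

/-! ### The algorithm -/

/-- The word with the first mode of the beamsplitter of the current block. -/
def fstWord : Expr := .get 0 (.add (.var 0) (.const 5))

/-- The word with the second mode of the beamsplitter of the current block. -/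
def sndWord : Expr := .get 0 (.add (.var 0) (.const 6))

/-- Process one block, going backwards through the network. -/
def backwardStep : Program :=
  .seq (.set 0 (.sub (.var 0) (.const 8)))
    (.seq (.put 3 (.var 0) (.sub (.get 2 fstWord) (.get 2 sndWord)))
      (.seq (.put 4 (.var 0) (.sub (.get 2 sndWord) (.get 2 fstWord)))
        -- With truncated subtraction `f - (f - s)` is `min f s`, so the stored surplus yields the
        -- new distance.
        (.seq (.put 2 fstWord (.add (.sub (.get 2 fstWord) (.get 3 (.var 0))) (.const 1)))
          (.put 2 sndWord (.get 2 fstWord)))))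

/-- Compare the number of layers with the number of loss elements in one mode. -/
def minimumStep : Program :=
  -- The same device computes a minimum: `x - (x - y) = min x y`.
  .seq (.set 2 (.sub (.var 2) (.sub (.var 2) (.get 2 (.var 3)))))
    (.set 3 (.add (.var 3) (.const 1)))

/-- Write the remaining loss elements at the input of one mode. -/
def inputStep : Program :=
  .seq (.set 4 (.sub (.get 2 (.var 3)) (.var 2)))
    (.seq (emitLosses (.var 3)) (.set 3 (.add (.var 3) (.const 1))))

/-- Write one beamsplitter and the remaining loss elements in its output arms. -/
def forwardStep : Program :=
  .seq (emit (.const 1)) (.seq (emit fstWord) (.seq (emit sndWord)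
    (.seq (emit (.get 0 (.add (.var 0) (.const 7))))
      (.seq (.set 4 (.get 3 (.var 0))) (.seq (emitLosses fstWord)
        (.seq (.set 4 (.get 4 (.var 0))) (.seq (emitLosses sndWord)
          (.set 0 (.add (.var 0) (.const 8))))))))))

/-- The program that pulls the losses out of a network. -/
def pullOutProgram : Program :=
  -- The input length is saved because register `0` becomes the position. It starts just past the
  -- last block, returns to `1` in the backward pass, and climbs to the saved value in the forward
  -- pass.
  .seq (.set 5 (.var 0)) (.seq (.loop (.const 1) (.var 0) backwardStep)
    (.seq (.set 2 (.get 2 (.const 0))) (.seq (.loop (.var 3) (.get 0 (.const 0)) minimumStep)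
      (.seq (emit (.get 0 (.const 0))) (.seq (.set 3 (.const 0))
        (.seq (.loop (.var 3) (.get 0 (.const 0)) inputStep)
          (.loop (.var 0) (.var 5) forwardStep)))))))

/-- The input words that the program reads. -/
structure HoldsInput {m : ℕ} (bs : List (Beamsplitter m)) (μ : Memory) : Prop where
  modes : μ.input 0 = m
  fst : ∀ (i : ℕ) (hi : i < bs.length), μ.input (1 + 8 * i + 5) = bs[i].fst
  snd : ∀ (i : ℕ) (hi : i < bs.length), μ.input (1 + 8 * i + 6) = bs[i].snd
  gate : ∀ (i : ℕ) (hi : i < bs.length), μ.input (1 + 8 * i + 7) = bs[i].gate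
  size : μ.size = 1 + 8 * bs.length

/-- The loss elements that remain in the output arms of the beamsplitters from number `i` on are
known. -/
structure HoldsExtra {m : ℕ} (bs : List (Beamsplitter m)) (i : ℕ) (μ : Memory) : Prop where
  fst : ∀ (j : ℕ) (hj : j < bs.length), i ≤ j → μ.fstExtra (1 + 8 * j) =
    outDist (bs.drop (j + 1)) bs[j].fst - outDist (bs.drop (j + 1)) bs[j].snd
  snd : ∀ (j : ℕ) (hj : j < bs.length), i ≤ j → μ.sndExtra (1 + 8 * j) =
    outDist (bs.drop (j + 1)) bs[j].snd - outDist (bs.drop (j + 1)) bs[j].fst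

theorem exec_backward {m : ℕ} (bs : List (Beamsplitter m)) (μ : Memory) (hin : HoldsInput bs μ)
    (hpos : μ.pos = 1 + 8 * bs.length) (hdist : μ.dist = fun _ => 0) (hout : μ.out = [])
    (hmode : μ.mode = 0) :
    ∃ μ', Exec (.loop (.const 1) (.var 0) backwardStep) μ μ' (bs.length * 80 + 3) ∧
      HoldsInput bs μ' ∧ HoldsExtra bs 0 μ' ∧ μ'.pos = 1 ∧ μ'.dist = outDist bs ∧ μ'.out = [] ∧
      μ'.mode = 0 := by
  -- After `k` passes the last `k` blocks are processed and the distance array is literally the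
  -- function `outDist` of the remaining suffix; for the empty suffix this is the zeroed initial
  -- array.
  obtain ⟨μ', hμ', h1, h2, h3, h4, h5, h6⟩ := exec_loop (fun k ν => HoldsInput bs ν ∧
      HoldsExtra bs (bs.length - k) ν ∧ ν.pos = 1 + 8 * (bs.length - k) ∧
      ν.dist = outDist (bs.drop (bs.length - k)) ∧ ν.out = [] ∧ ν.mode = 0)
    (.const 1) (.var 0) backwardStep bs.length 77 (by
      rintro k ν hk ⟨hin, hex, hpos, hdist, hout, hmode⟩
      obtain ⟨i, hi⟩ : ∃ i, bs.length - k = i + 1 := ⟨bs.length - k - 1, by omega⟩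
      have hi' : bs.length - (k + 1) = i := by omega
      have hil : i < bs.length := by omega
      rw [hi] at hex hpos hdist
      rw [hi']
      refine ⟨by simp only [Expr.eval, Memory.toStore, hpos]; omega, _,
        ((exec_set_pos _ _).seq ((exec_put_fstExtra _ _ _).seq ((exec_put_sndExtra _ _ _).seq
          ((exec_put_dist _ _ _).seq (exec_put_dist _ _ _))))).mono
          (by simp [Expr.cost, fstWord, sndWord]), ?_⟩
      have hsub : 1 + 8 * (i + 1) - 8 = 1 + 8 * i := by omega
      simp only [Expr.eval, Memory.toStore, fstWord, sndWord, hpos, hsub, hin.fst i hil,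
        hin.snd i hil, hdist, Function.update_self]
      refine ⟨⟨hin.modes, hin.fst, hin.snd, hin.gate, hin.size⟩, ⟨?_, ?_⟩, trivial, ?_, hout, hmode⟩
      · intro j hj hij
        rcases hij.eq_or_lt with rfl | hlt
        · simp
        · dsimp only
          rw [Function.update_of_ne (by omega)]
          exact hex.fst j hj hlt
      · intro j hj hij
        rcases hij.eq_or_lt with rfl | hlt
        · simp
        · dsimp only
          rw [Function.update_of_ne (by omega)]
          exact hex.snd j hj hlt
      · funext a
        rw [List.drop_eq_getElem_cons hil, outDist]
        simp only [Function.update_apply]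
        split_ifs <;> first | rfl | omega)
    (by
      rintro ν ⟨_, _, hpos, _⟩
      simp [Expr.eval, Memory.toStore, hpos])
    (μ := μ) ⟨hin, ⟨fun j hj h => absurd hj (by omega), fun j hj h => absurd hj (by omega)⟩,
      by simpa using hpos, by rw [Nat.sub_zero, List.drop_length, hdist]; rfl, hout, hmode⟩
  rw [Nat.sub_self] at h2 h3 h4
  exact ⟨μ', hμ'.mono (by simp [Expr.cost]), h1, h2, h3, h4, h5, h6⟩

/-- The invariant keeps the candidate below the values seen so far and equal to some value of the
array. Attainment is why the candidate starts as an entry of the array and not as `0`. -/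
theorem exec_minimum {m : ℕ} (bs : List (Beamsplitter m)) (μ : Memory) (hin : HoldsInput bs μ)
    (hex : HoldsExtra bs 0 μ) (hpos : μ.pos = 1) (hdist : μ.dist = outDist bs)
    (hout : μ.out = []) (hmode : μ.mode = 0) (hlay : ∃ a < m, μ.layers = outDist bs a) :
    ∃ μ', Exec (.loop (.var 3) (.get 0 (.const 0)) minimumStep) μ μ' (m * 20 + 4) ∧
      HoldsInput bs μ' ∧ HoldsExtra bs 0 μ' ∧ μ'.pos = 1 ∧ μ'.dist = outDist bs ∧ μ'.out = [] ∧
      (∀ a < m, μ'.layers ≤ outDist bs a) ∧ ∃ a < m, μ'.layers = outDist bs a := by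
  obtain ⟨μ', hμ', h1, h2, h3, h4, h5, h6, h7, h8⟩ := exec_loop (fun k ν => HoldsInput bs ν ∧
      HoldsExtra bs 0 ν ∧ ν.pos = 1 ∧ ν.dist = outDist bs ∧ ν.out = [] ∧ ν.mode = k ∧
      (∀ a < k, ν.layers ≤ outDist bs a) ∧ ∃ a < m, ν.layers = outDist bs a)
    (.var 3) (.get 0 (.const 0)) minimumStep m 16 (by
      rintro k ν hk ⟨hin, hex, hpos, hdist, hout, hmode, hle, a₀, ha₀, hlay⟩
      refine ⟨by simpa [Expr.eval, Memory.toStore, hin.modes, hmode] using hk, _,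
        ((exec_set_layers _ _).seq (exec_set_mode _ _)).mono (by simp [Expr.cost]), ?_⟩
      simp only [Expr.eval, Memory.toStore, hdist, hmode]
      refine ⟨⟨hin.modes, hin.fst, hin.snd, hin.gate, hin.size⟩, ⟨hex.fst, hex.snd⟩, hpos,
        trivial, hout, trivial, ?_, ?_⟩
      · intro a ha
        rcases Nat.lt_succ_iff_lt_or_eq.1 ha with h | rfl
        · exact (Nat.sub_le _ _).trans (hle a h)
        · omega
      · rcases le_total ν.layers (outDist bs k) with h | h
        · exact ⟨a₀, ha₀, by omega⟩
        · exact ⟨k, hk, by omega⟩)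
    (by
      rintro ν ⟨hin, _, _, _, _, hmode, _⟩
      simp [Expr.eval, Memory.toStore, hin.modes, hmode])
    (μ := μ) ⟨hin, hex, hpos, hdist, hout, hmode, fun a ha => absurd ha (Nat.not_lt_zero a), hlay⟩
  exact ⟨μ', hμ'.mono (by simp [Expr.cost]), h1, h2, h3, h4, h5, h7, h8⟩

theorem exec_input {m : ℕ} (bs : List (Beamsplitter m)) (s : ℕ) (μ : Memory)
    (hin : HoldsInput bs μ) (hex : HoldsExtra bs 0 μ) (hpos : μ.pos = 1)
    (hdist : μ.dist = outDist bs) (hout : μ.out = [m]) (hmode : μ.mode = 0)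
    (hlay : μ.layers = s) :
    ∃ μ', Exec (.loop (.var 3) (.get 0 (.const 0)) inputStep) μ μ'
        (m * (bs.length * 21 + 20) + 4) ∧
      HoldsInput bs μ' ∧ HoldsExtra bs 0 μ' ∧ μ'.pos = 1 ∧
      μ'.out = m :: ((List.range m).flatMap fun a =>
        (List.replicate (outDist bs a - s) [0, a]).flatten) := by
  obtain ⟨μ', hμ', h1, h2, h3, h4, h5, h6, h7⟩ := exec_loop (fun k ν => HoldsInput bs ν ∧
      HoldsExtra bs 0 ν ∧ ν.pos = 1 ∧ ν.dist = outDist bs ∧ ν.mode = k ∧ ν.layers = s ∧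
      ν.out = m :: ((List.range k).flatMap fun a =>
        (List.replicate (outDist bs a - s) [0, a]).flatten))
    (.var 3) (.get 0 (.const 0)) inputStep m (bs.length * 21 + 16) (by
      rintro k ν hk ⟨hin, hex, hpos, hdist, hmode, hlay, hout⟩
      refine ⟨by simpa [Expr.eval, Memory.toStore, hin.modes, hmode] using hk, _,
        ((exec_set_count _ _).seq ((exec_emitLosses _ _ k
          (fun l c => by simp [Expr.eval, Memory.toStore, hmode])).seq
            (exec_set_mode _ _))).mono ?_, ?_⟩
      -- No mode has more losses than there are beamsplitters, which bounds the length of the inner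
      -- loop.
      · have := outDist_le_length bs k
        simp only [Expr.eval, Expr.cost, Memory.toStore, hdist, hmode, hlay]
        have h2 : (outDist bs k - s) * 21 ≤ bs.length * 21 :=
          Nat.mul_le_mul_right _ ((Nat.sub_le _ _).trans this)
        omega
      · simp only [Expr.eval, Memory.toStore, hdist, hmode, hlay, hout]
        refine ⟨⟨hin.modes, hin.fst, hin.snd, hin.gate, hin.size⟩, ⟨hex.fst, hex.snd⟩, hpos,
          trivial, trivial, trivial, ?_⟩
        rw [List.range_succ, List.flatMap_append]
        simp)
    (by
      rintro ν ⟨hin, _, _, _, hmode, _⟩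
      simp [Expr.eval, Memory.toStore, hin.modes, hmode])
    (μ := μ) ⟨hin, hex, hpos, hdist, hmode, hlay, by simpa using hout⟩
  exact ⟨μ', hμ'.mono (le_of_eq (by simp only [Expr.cost]; ring)), h1, h2, h3, h7⟩

theorem exec_forward {m : ℕ} (bs : List (Beamsplitter m)) (μ : Memory)
    (hin : HoldsInput bs μ) (hex : HoldsExtra bs 0 μ) (hpos : μ.pos = 1) :
    ∃ μ', Exec (.loop (.var 0) (.var 5) forwardStep) μ μ'
        (bs.length * (bs.length * 48 + 90) + 3) ∧
      μ'.out = μ.out ++ (lossyCore bs).flatMap Component.words := by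
  -- The invariant is that the output so far, followed by the words still due, is the final output.
  -- In the time bound, `48` is twice the `24` steps for writing one loss, for the two arms.
  obtain ⟨μ', hμ', h1, h2, h3, h4⟩ := exec_loop (fun k ν => HoldsInput bs ν ∧
      HoldsExtra bs 0 ν ∧ ν.pos = 1 + 8 * k ∧
      ν.out ++ (lossyCore (bs.drop k)).flatMap Component.words =
        μ.out ++ (lossyCore bs).flatMap Component.words)
    (.var 0) (.var 5) forwardStep bs.length (bs.length * 48 + 87) (by
      rintro k ν hk ⟨hin, hex, hpos, hout⟩
      refine ⟨by simp only [Expr.eval, Memory.toStore, hin.size, hpos]; omega, _,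
        ((exec_emit _ _).seq ((exec_emit _ _).seq ((exec_emit _ _).seq ((exec_emit _ _).seq
          ((exec_set_count _ _).seq ((exec_emitLosses _ _ bs[k].fst (fun l c => by
            simp [Expr.eval, Memory.toStore, fstWord, hpos, hin.fst k hk])).seq
          ((exec_set_count _ _).seq ((exec_emitLosses _ _ bs[k].snd (fun l c => by
            simp [Expr.eval, Memory.toStore, sndWord, hpos, hin.snd k hk])).seq
              (exec_set_pos _ _))))))))).mono ?_, ?_⟩
      · simp only [Expr.eval, Expr.cost, Memory.toStore, hpos, hex.fst k hk (Nat.zero_le k),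
          hex.snd k hk (Nat.zero_le k), fstWord, sndWord]
        have h1 := outDist_le_length (bs.drop (k + 1)) bs[k].fst
        have h2 := outDist_le_length (bs.drop (k + 1)) bs[k].snd
        rw [List.length_drop] at h1 h2
        omega
      · simp only [Expr.eval, Memory.toStore, hpos, hex.fst k hk (Nat.zero_le k),
          hex.snd k hk (Nat.zero_le k), fstWord, sndWord, hin.fst k hk, hin.snd k hk,
          hin.gate k hk]
        refine ⟨⟨hin.modes, hin.fst, hin.snd, hin.gate, hin.size⟩, ⟨hex.fst, hex.snd⟩, rfl, ?_⟩
        rw [← hout, List.drop_eq_getElem_cons hk, words_lossyCore_cons]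
        simp)
    (by
      rintro ν ⟨hin, _, hpos, _⟩
      simp [Expr.eval, Memory.toStore, hin.size, hpos])
    (μ := μ) ⟨hin, hex, by simpa using hpos, by simp⟩
  refine ⟨μ', hμ'.mono (le_of_eq (by simp only [Expr.cost]; ring)), ?_⟩
  rw [← h4, List.drop_length]
  simp [lossyCore]

theorem pullOutProgram_computes {m : ℕ} (bs : List (Beamsplitter m)) (s : ℕ)
    (hle : ∀ a < m, s ≤ outDist bs a) (hs : ∃ a < m, s = outDist bs a) :
    ComputesWithin pullOutProgram (describe (lossyNetwork bs)) (describe (reducedNetwork bs s))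
      (100 * (m + (lossyNetwork bs).length + 1) ^ 2) := by
  have hlen : (lossyNetwork bs).length = 3 * bs.length := by
    induction bs with
    | nil => rfl
    | cons b bs _ => simp [lossyNetwork, block, List.length_flatMap]; omega
  let μ₀ : Memory := ⟨(describe (lossyNetwork bs)).length, [], 0, 0, 0, 0,
    fun k => (describe (lossyNetwork bs)).getD k 0, fun _ => 0, fun _ => 0, fun _ => 0⟩
  have hμ₀ : initialStore (describe (lossyNetwork bs)) = μ₀.toStore := by
    refine congrArg₂ Store.mk (funext fun r => ?_) (funext fun A => funext fun k => ?_)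
    · rcases r with _ | _ | _ | _ | _ | _ | r <;> rfl
    · rcases A with _ | _ | _ | _ | _ | A <;> rfl
  have hget := describe_lossyNetwork_getD bs
  have hsize := describe_lossyNetwork_length bs
  have e₁ := exec_set_size (.var 0) μ₀
  obtain ⟨μ₂, e₂, hin₂, hex₂, hpos₂, hdist₂, hout₂, hmode₂⟩ := exec_backward bs
    { μ₀ with size := (Expr.var 0).eval μ₀.toStore }
    ⟨rfl, fun i hi => hget i hi 5 (by norm_num), fun i hi => hget i hi 6 (by norm_num),
      fun i hi => hget i hi 7 (by norm_num), hsize⟩ hsize rfl rfl rfl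
  obtain ⟨a₀, ha₀, hsa₀⟩ := hs
  have e₃ := exec_set_layers (.get 2 (.const 0)) μ₂
  obtain ⟨μ₄, e₄, hin₄, hex₄, hpos₄, hdist₄, hout₄, hlow, a₁, ha₁, hlay⟩ := exec_minimum bs
    { μ₂ with layers := (Expr.get 2 (.const 0)).eval μ₂.toStore }
    ⟨hin₂.modes, hin₂.fst, hin₂.snd, hin₂.gate, hin₂.size⟩ ⟨hex₂.fst, hex₂.snd⟩ hpos₂ hdist₂ hout₂
    hmode₂ ⟨0, by omega, by simp [Expr.eval, Memory.toStore, hdist₂]⟩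
  have hlayers : μ₄.layers = s := by
    have h1 := hlow a₀ ha₀
    have h2 := hle a₁ ha₁
    omega
  have e₅ := exec_emit (.get 0 (.const 0)) μ₄
  have e₆ := exec_set_mode (.const 0)
    { μ₄ with out := μ₄.out ++ [(Expr.get 0 (.const 0)).eval μ₄.toStore] }
  have hout₅ : μ₄.out ++ [(Expr.get 0 (.const 0)).eval μ₄.toStore] = [m] := by
    simp [hout₄, Expr.eval, Memory.toStore, hin₄.modes]
  obtain ⟨μ₇, e₇, hin₇, hex₇, hpos₇, hout₇⟩ := exec_input bs s
    { μ₄ with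
      out := μ₄.out ++ [(Expr.get 0 (.const 0)).eval μ₄.toStore], mode := 0 }
    ⟨hin₄.modes, hin₄.fst, hin₄.snd, hin₄.gate, hin₄.size⟩ ⟨hex₄.fst, hex₄.snd⟩ hpos₄ hdist₄
    hout₅ rfl hlayers
  obtain ⟨μ₈, e₈, hout₈⟩ := exec_forward bs μ₇ hin₇ hex₇ hpos₇
  obtain ⟨t, ht, hr⟩ := e₁.seq (e₂.seq (e₃.seq (e₄.seq (e₅.seq (e₆.seq (e₇.seq e₈))))))
  have hout : μ₈.out = describe (reducedNetwork bs s) := by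
    rw [hout₈, hout₇, describe_reducedNetwork]
  refine ⟨μ₈.toStore, t, ht.trans ?_, hμ₀ ▸ hr, ?_, ?_⟩
  · simp only [Expr.cost, hlen]
    generalize bs.length = L
    nlinarith [Nat.zero_le (m * L), Nat.zero_le (L * L), Nat.zero_le (m * m)]
  · rw [← hout]; rfl
  · intro k _
    rw [← hout]; rfl

end LossyOptics

/-- One fixed program computes, in time polynomial in the number of modes and the number of components,
for every network `N` constructed out of lossy building blocks a network `N'` that is left over when `s`
uniform layers of losses (hence `s * m` loss elements) are pulled out of `N`, where `s` is the smallest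
number of beamsplitters on a path from an input to an output; and `Λ_N = Λ_{N'} ∘ Λ_{η^s}`
for every choice of the unitaries and of the transmissivity. -/
theorem theorem2 :
    ∃ (P : LossyOptics.Program) (T : Polynomial ℕ),
      ∀ (m : ℕ) (bs : List (LossyOptics.Beamsplitter m)) (s : ℕ),
        IsLeast {k : ℕ | ∃ a b : Fin m,
          LossyOptics.PathCrosses (LossyOptics.lossyNetwork bs) a b k} s →
        ∃ N' : LossyOptics.Network m,
          LossyOptics.PullsOut (LossyOptics.lossyNetwork bs) s N' ∧
          LossyOptics.beamsplitters N' = bs ∧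
          LossyOptics.lossCount N' + s * m =
            LossyOptics.lossCount (LossyOptics.lossyNetwork bs) ∧
          LossyOptics.ComputesWithin P
            (LossyOptics.describe (LossyOptics.lossyNetwork bs)) (LossyOptics.describe N')
            (T.eval (m + (LossyOptics.lossyNetwork bs).length)) ∧
          ∀ (U : ℕ → Matrix.unitaryGroup (Fin 2) ℂ) (η : ℝ), 0 ≤ η → η ≤ 1 →
            ∀ ρ : LossyOptics.FockOp m, LossyOptics.IsState ρ →
              LossyOptics.networkChannel U η (LossyOptics.lossyNetwork bs) ρ =
                LossyOptics.networkChannel U η N' (LossyOptics.uniformLoss (η ^ s) ρ) := by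
  refine ⟨LossyOptics.pullOutProgram, 100 * (Polynomial.X + 1) ^ 2, fun m bs s hs => ?_⟩
  have hle : ∀ a : Fin m, s ≤ LossyOptics.outDist bs a := fun a =>
    hs.2 ⟨a, LossyOptics.exists_pathCrosses_outDist bs a⟩
  -- A shortest path supplies its entry mode, which shows that the minimum distance is attained and
  -- that there is at least one mode.
  obtain ⟨a, b, hab⟩ := hs.1
  have hsa : s = LossyOptics.outDist bs a :=
    le_antisymm (hle a) (LossyOptics.outDist_le_of_pathCrosses bs hab)
  have hN := LossyOptics.pullsOut_reducedNetwork bs s hle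
  refine ⟨LossyOptics.reducedNetwork bs s, hN, LossyOptics.beamsplitters_reducedNetwork bs s,
    LossyOptics.lossCount_of_pullsOut hN, ?_, fun U η h0 h1 ρ hρ =>
      LossyOptics.networkChannel_of_pullsOut U h0 h1 hN hρ.isTraceClass⟩
  have := LossyOptics.pullOutProgram_computes bs s (fun a ha => hle ⟨a, ha⟩) ⟨a, a.2, hsa⟩
  simpa using this
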